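/- Let $k$ be a commutative unital ring, $G$ any group, and let all algebras be associative $k$-algebras, not necessarily unital. For $k$-submodules $P,Q$ of an algebra (or of an algebra and a module over it) $PQ$ denotes the $k$-submodule spanned by all products $pq$. For a $G$-graded algebra $A=\bigoplus_{t\in G}A_t$ put $D_t^A=A_tA_{t^{-1}}$, a two-sided ideal of $A_1$. *Strong-graded-equivalence.* Two $G$-graded algebras $A$ and $B$ such that $A^2=A$, $B^2=B$ and all $D_t^A$, $D_t^B$ are idempotent are called strongly-graded-equivalent if there is a Morita context $(A,B,X,Y,\tau_A,\tau_B)$, where $X=\bigoplus_t X_t$ is a graded $(A,B)$-bimodule, $Y=\bigoplus_t Y_t$ is a graded $(B,A)$-bimodule and $\tau_A:X\otimes_BY\to A$, $\tau_B:Y\otimes_AX\to B$ are bimodule maps (with the usual compatibilities $\tau_A(x\otimes y)x'=x\,\tau_B(y\otimes x')$ and $\tau_B(y\otimes x)y'=y\,\tau_A(x\otimes y')$), such that for all $r,s,t\in G$: (i) $\tau_A(X_r\otimes Y_s)\subseteq A_{rs}$ and $\tau_B(Y_r\otimes X_s)\subseteq B_{rs}$; (ii) $D_t^AX_t=X_t=X_tD_{t^{-1}}^B$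 and $D_t^BY_t=Y_t=Y_tD_{t^{-1}}^A$; (iii) $\tau_A$ and $\tau_B$ are surjective, $\tau_A(X_t\otimes Y_{t^{-1}})=D_t^A$ and $\tau_B(Y_t\otimes X_{t^{-1}})=D_t^B$. *The partial smash product.* For a $G$-graded algebra $B$, let $B\#G=\bigoplus_{r,s\in G}B_{r^{-1}s}e_{r,s}$, a subalgebra of the algebra of finitely supported $G\times G$-matrices over $B$, where $b\,e_{r,s}$ is the matrix with the only possibly non-zero entry $b$ at the position $(r,s)$. Let $\beta^B$ be the dual action of $G$ on $B\#G$, $\beta^B_t(b\,e_{r,s})=b\,e_{tr,ts}$, and let $I^B=\bigoplus_{r,s\in G}B_{r^{-1}}B_s\,e_{r,s}$, a two-sided ideal of $B\#G$. *The canonical partial action.* A product partial action of $G$ on an algebra $A$ consists of two-sided ideals $D_t$ of $A$ and algebra isomorphisms $\alpha_t:D_{t^{-1}}\to D_t$ $(t\in G)$ such that $D_1=A$, $\alpha_1=\mathrm{id}$, $D_t^2=D_t$, $D_sD_t=D_tD_s$, $\alpha_s(D_{s^{-1}}D_t)=D_sD_{st}$, and $\alpha_s(\alpha_t(x))=\alpha_{st}(x)$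 for $x\in D_{t^{-1}}D_{(st)^{-1}}$. Its skew group algebra is the $G$-graded algebra $A\rtimes_\alpha G=\bigoplus_{t\in G}D_t\delta_t$ with $(a\delta_r)(b\delta_s)=\alpha_r(\alpha_r^{-1}(a)b)\delta_{rs}$. If $B$ is partially-strongly-graded, i.e. $B_t=B_tB_{t^{-1}}B_t$ for all $t\in G$, then $\beta^B$ restricts to a product partial action $\gamma^B$ on $I=I^B$, with domains $I_t=I\,\beta^B_t(I)=\beta^B_t(I)\,I$ and $\gamma^B_t=\beta^B_t|_{I_{t^{-1}}}$. **Theorem.** Let $B=\bigoplus_{t\in G}B_t$ be a partially-strongly-graded algebra. Then $B$ is strongly-graded-equivalent to the partial skew group algebra $I^B\rtimes_{\gamma^B}G$. -/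

import Mathlib

open scoped TensorProduct DirectSum

set_option linter.unusedSectionVars false
set_option linter.checkUnivs false

noncomputable section

universe uk uG uA uB uX uY

/-! ### Products of submodules and group gradings of non-unital algebras -/

section Algebras

variable {k : Type uk} [CommRing k] {A : Type uA} [NonUnitalRing A] [Module k A]
  [IsScalarTower k A A] [SMulCommClass k A A]

/-- The product `P Q` of two `k`-submodules of a (possibly non-unital) `k`-algebra: the
`k`-submodule spanned by all products `p * q` with `p ∈ P`, `q ∈ Q`. -/
def mulSub (P Q : Submodule k A) : Submodule k A :=
  Submodule.map₂ (LinearMap.mul k A) P Q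

infixl:70 " ⬝ₛ " => mulSub

theorem mulSub_mem {P Q : Submodule k A} {x y : A} (hx : x ∈ P) (hy : y ∈ Q) :
    x * y ∈ P ⬝ₛ Q :=
  Submodule.apply_mem_map₂ (LinearMap.mul k A) hx hy

theorem mulSub_le {P Q R : Submodule k A} :
    P ⬝ₛ Q ≤ R ↔ ∀ x ∈ P, ∀ y ∈ Q, x * y ∈ R :=
  Submodule.map₂_le

theorem mulSub_mono {P P' Q Q' : Submodule k A} (h : P ≤ P') (h' : Q ≤ Q') :
    P ⬝ₛ Q ≤ P' ⬝ₛ Q' :=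
  Submodule.map₂_le_map₂ h h'

theorem mulSub_assoc (P Q R : Submodule k A) : P ⬝ₛ Q ⬝ₛ R = P ⬝ₛ (Q ⬝ₛ R) := by
  apply le_antisymm
  · rw [mulSub_le]
    intro x hx y hy
    have : P ⬝ₛ Q ≤ (P ⬝ₛ (Q ⬝ₛ R)).comap ((LinearMap.mul k A).flip y) := by
      rw [mulSub_le]
      intro p hp q hq
      simp only [Submodule.mem_comap, LinearMap.flip_apply, LinearMap.mul_apply', mul_assoc]
      exact mulSub_mem hp (mulSub_mem hq hy)
    exact this hx
  · rw [mulSub_le]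
    intro x hx y hy
    have : Q ⬝ₛ R ≤ (P ⬝ₛ Q ⬝ₛ R).comap (LinearMap.mul k A x) := by
      rw [mulSub_le]
      intro p hp q hq
      simp only [Submodule.mem_comap, LinearMap.mul_apply', ← mul_assoc]
      exact mulSub_mem (mulSub_mem hx hp) hq
    exact this hy

variable (k A) in
/-- `A` is idempotent: `A A = A`. -/
def IsIdempotentAlgebra : Prop := (⊤ : Submodule k A) ⬝ₛ ⊤ = ⊤

end Algebras

open scoped Classical in
/-- A grading of the `k`-algebra `A` by the group `G`: `A = ⨁ A_t` as a `k`-module, with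
`A_s A_t ⊆ A_{st}`. -/
structure GroupGrading (k : Type uk) (G : Type uG) (A : Type uA) [CommRing k] [Group G]
    [NonUnitalRing A] [Module k A] where
  /-- the homogeneous component `A_t` -/
  comp : G → Submodule k A
  isInternal : DirectSum.IsInternal comp
  mul_mem : ∀ {s t : G} {a b : A}, a ∈ comp s → b ∈ comp t → a * b ∈ comp (s * t)

section Gradings

variable {k : Type uk} [CommRing k] {G : Type uG} [Group G]
  {A : Type uA} [NonUnitalRing A] [Module k A] [IsScalarTower k A A] [SMulCommClass k A A]
  {B : Type uB} [NonUnitalRing B] [Module k B] [IsScalarTower k B B] [SMulCommClass k B B]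

namespace GroupGrading

/-- The ideal `D_t = A_t A_{t⁻¹}` of `A_1`. -/
def ideal (𝒜 : GroupGrading k G A) (t : G) : Submodule k A := 𝒜.comp t ⬝ₛ 𝒜.comp t⁻¹

/-- `A` is partially-strongly-graded: `A_t A_{t⁻¹} A_t = A_t` for all `t`. -/
def IsPartiallyStronglyGraded (𝒜 : GroupGrading k G A) : Prop :=
  ∀ t : G, 𝒜.comp t = 𝒜.comp t ⬝ₛ 𝒜.comp t⁻¹ ⬝ₛ 𝒜.comp t

theorem mulSub_comp_le (𝒜 : GroupGrading k G A) (s t : G) :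
    𝒜.comp s ⬝ₛ 𝒜.comp t ≤ 𝒜.comp (s * t) :=
  mulSub_le.2 fun _ hx _ hy => 𝒜.mul_mem hx hy

theorem mulSub_comp_le' (𝒜 : GroupGrading k G A) {s t u : G} (h : s * t = u) :
    𝒜.comp s ⬝ₛ 𝒜.comp t ≤ 𝒜.comp u :=
  h ▸ 𝒜.mulSub_comp_le s t

end GroupGrading

/-! ### Graded bimodules, graded Morita contexts, strong-graded-equivalence -/

open scoped Classical in
/-- A `G`-graded `(A, B)`-bimodule `X = ⨁ X_t` over the (non-unital) graded algebras `A`, `B`. -/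
structure GradedBimodule (𝒜 : GroupGrading k G A) (ℬ : GroupGrading k G B) where
  /-- the underlying `k`-module -/
  carrier : Type uX
  [addCommGroup : AddCommGroup carrier]
  [module : Module k carrier]
  /-- the left action of `A` -/
  left : A →ₗ[k] carrier →ₗ[k] carrier
  /-- the right action of `B` -/
  right : carrier →ₗ[k] B →ₗ[k] carrier
  left_mul : ∀ a a' x, left (a * a') x = left a (left a' x)
  right_mul : ∀ x b b', right x (b * b') = right (right x b) b'
  left_right : ∀ a x b, right (left a x) b = left a (right x b)
  /-- the homogeneous component `X_t` -/
  comp : G → Submodule k carrier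
  isInternal : DirectSum.IsInternal comp
  left_mem : ∀ {s t : G} {a : A} {x : carrier}, a ∈ 𝒜.comp s → x ∈ comp t →
    left a x ∈ comp (s * t)
  right_mem : ∀ {s t : G} {x : carrier} {b : B}, x ∈ comp s → b ∈ ℬ.comp t →
    right x b ∈ comp (s * t)

attribute [instance] GradedBimodule.addCommGroup GradedBimodule.module

/-- `X ⊗_B Y`: the quotient of `X ⊗_k Y` by the relations `xb ⊗ y = x ⊗ by`. -/
abbrev BalancedTensor {𝒜 : GroupGrading k G A} {ℬ : GroupGrading k G B}
    (X : GradedBimodule.{uk, uG, uA, uB, uX} 𝒜 ℬ)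
    (Y : GradedBimodule.{uk, uG, uB, uA, uY} ℬ 𝒜) :=
  (X.carrier ⊗[k] Y.carrier) ⧸ Submodule.span k
    {z : X.carrier ⊗[k] Y.carrier | ∃ x b y, z = X.right x b ⊗ₜ[k] y - x ⊗ₜ[k] Y.left b y}

/-- The bilinear map `(x, y) ↦ x ⊗ y ∈ X ⊗_B Y`. -/
def balancedTmul {𝒜 : GroupGrading k G A} {ℬ : GroupGrading k G B}
    (X : GradedBimodule.{uk, uG, uA, uB, uX} 𝒜 ℬ)
    (Y : GradedBimodule.{uk, uG, uB, uA, uY} ℬ 𝒜) :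
    X.carrier →ₗ[k] Y.carrier →ₗ[k] BalancedTensor X Y :=
  (TensorProduct.mk k X.carrier Y.carrier).compr₂ (Submodule.mkQ _)

/-- For submodules `X' ⊆ X` and `Y' ⊆ Y`, the submodule `X' ⊗_B Y'` of `X ⊗_B Y` generated by
all `x ⊗ y` with `x ∈ X'`, `y ∈ Y'`. -/
def balancedSub {𝒜 : GroupGrading k G A} {ℬ : GroupGrading k G B}
    (X : GradedBimodule.{uk, uG, uA, uB, uX} 𝒜 ℬ)
    (Y : GradedBimodule.{uk, uG, uB, uA, uY} ℬ 𝒜)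
    (X' : Submodule k X.carrier) (Y' : Submodule k Y.carrier) :
    Submodule k (BalancedTensor X Y) :=
  Submodule.map₂ (balancedTmul X Y) X' Y'

/-- A graded Morita context `(A, B, X, Y, τ_A, τ_B)`. -/
structure GradedMoritaContext (𝒜 : GroupGrading k G A) (ℬ : GroupGrading k G B) where
  X : GradedBimodule.{uk, uG, uA, uB, uX} 𝒜 ℬ
  Y : GradedBimodule.{uk, uG, uB, uA, uY} ℬ 𝒜
  τA : BalancedTensor X Y →ₗ[k] A
  τB : BalancedTensor Y X →ₗ[k] B
  τA_left : ∀ a x y, τA (balancedTmul X Y (X.left a x) y) = a * τA (balancedTmul X Y x y)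
  τA_right : ∀ x y a, τA (balancedTmul X Y x (Y.right y a)) = τA (balancedTmul X Y x y) * a
  τB_left : ∀ b y x, τB (balancedTmul Y X (Y.left b y) x) = b * τB (balancedTmul Y X y x)
  τB_right : ∀ y x b, τB (balancedTmul Y X y (X.right x b)) = τB (balancedTmul Y X y x) * b
  assocX : ∀ x y x', X.left (τA (balancedTmul X Y x y)) x' =
    X.right x (τB (balancedTmul Y X y x'))
  assocY : ∀ y x y', Y.left (τB (balancedTmul Y X y x)) y' =
    Y.right y (τA (balancedTmul X Y x y'))
  τA_mem : ∀ r s, (balancedSub X Y (X.comp r) (Y.comp s)).map τA ≤ 𝒜.comp (r * s)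
  τB_mem : ∀ r s, (balancedSub Y X (Y.comp r) (X.comp s)).map τB ≤ ℬ.comp (r * s)

/-- The context is strong: each `X_t` is a unital `(D_t^A, D_{t⁻¹}^B)`-bimodule and each `Y_t` is
a unital `(D_t^B, D_{t⁻¹}^A)`-bimodule. -/
structure GradedMoritaContext.IsStrong {𝒜 : GroupGrading k G A} {ℬ : GroupGrading k G B}
    (M : GradedMoritaContext.{uk, uG, uA, uB, uX, uY} 𝒜 ℬ) : Prop where
  left_X : ∀ t, Submodule.map₂ M.X.left (𝒜.ideal t) (M.X.comp t) = M.X.comp t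
  right_X : ∀ t, Submodule.map₂ M.X.right (M.X.comp t) (ℬ.ideal t⁻¹) = M.X.comp t
  left_Y : ∀ t, Submodule.map₂ M.Y.left (ℬ.ideal t) (M.Y.comp t) = M.Y.comp t
  right_Y : ∀ t, Submodule.map₂ M.Y.right (M.Y.comp t) (𝒜.ideal t⁻¹) = M.Y.comp t

/-- Strong-graded-equivalence of graded algebras. The algebras and all ideals `D_t` are required
to be idempotent, and there is a strong graded Morita context with `τ_A`, `τ_B` surjective, such
that `τ_A (X_t ⊗ Y_{t⁻¹}) = D_t^A` and `τ_B (Y_t ⊗ X_{t⁻¹}) = D_t^B` for all `t`. -/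
def StronglyGradedEquivalent (𝒜 : GroupGrading k G A) (ℬ : GroupGrading k G B) : Prop :=
  IsIdempotentAlgebra k A ∧ IsIdempotentAlgebra k B ∧
  (∀ t, 𝒜.ideal t ⬝ₛ 𝒜.ideal t = 𝒜.ideal t) ∧ (∀ t, ℬ.ideal t ⬝ₛ ℬ.ideal t = ℬ.ideal t) ∧
  ∃ M : GradedMoritaContext.{uk, uG, uA, uB, max uA uB, max uA uB} 𝒜 ℬ,
    M.IsStrong ∧ Function.Surjective M.τA ∧ Function.Surjective M.τB ∧
    (∀ t, (balancedSub M.X M.Y (M.X.comp t) (M.Y.comp t⁻¹)).map M.τA = 𝒜.ideal t) ∧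
    (∀ t, (balancedSub M.Y M.X (M.Y.comp t) (M.X.comp t⁻¹)).map M.τB = ℬ.ideal t)

end Gradings

/-! ### Product partial actions and their skew group algebras -/

/-- A product partial action of the group `G` on the `k`-algebra `A`: two-sided ideals `D_t` and
algebra isomorphisms `α_t : D_{t⁻¹} → D_t`. -/
structure ProductPartialAction (k : Type uk) (G : Type uG) (A : Type uA) [CommRing k] [Group G]
    [NonUnitalRing A] [Module k A] [IsScalarTower k A A] [SMulCommClass k A A] where
  D : G → Submodule k A
  mul_mem_left : ∀ (t : G) (a : A) {x : A}, x ∈ D t → a * x ∈ D t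
  mul_mem_right : ∀ (t : G) {x : A} (a : A), x ∈ D t → x * a ∈ D t
  α : ∀ t : G, D t⁻¹ ≃ₗ[k] D t
  α_mul : ∀ (t : G) (x y z : D t⁻¹), (z : A) = x * y → (α t z : A) = α t x * α t y
  D_one : D 1 = ⊤
  α_one : ∀ x : D (1 : G)⁻¹, (α 1 x : A) = x
  D_idem : ∀ t, D t ⬝ₛ D t = D t
  D_comm : ∀ s t, D s ⬝ₛ D t = D t ⬝ₛ D s
  α_image : ∀ s t, ((D s⁻¹ ⬝ₛ D t).comap (D s⁻¹).subtype).map ((D s).subtype ∘ₗ (α s).toLinearMap)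
    = D s ⬝ₛ D (s * t)
  α_comp : ∀ (s t : G) (x : D t⁻¹), (x : A) ∈ D t⁻¹ ⬝ₛ D (s * t)⁻¹ →
    ∀ (y : D s⁻¹) (z : D (s * t)⁻¹), (y : A) = α t x → (z : A) = x → (α s y : A) = α (s * t) z

namespace ProductPartialAction

variable {k : Type uk} [CommRing k] {G : Type uG} [Group G]
  {A : Type uA} [NonUnitalRing A] [Module k A] [IsScalarTower k A A] [SMulCommClass k A A]

theorem α_mem (α : ProductPartialAction k G A) {s t : G} (x : α.D s⁻¹)
    (hx : (x : A) ∈ α.D s⁻¹ ⬝ₛ α.D t) : (α.α s x : A) ∈ α.D s ⬝ₛ α.D (s * t) := by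
  rw [← α.α_image]
  exact Submodule.mem_map.2 ⟨x, hx, rfl⟩

theorem mulSub_D_le_right (α : ProductPartialAction k G A) (s t : G) :
    α.D s ⬝ₛ α.D t ≤ α.D t :=
  mulSub_le.2 fun x _ _ hy => α.mul_mem_left t x hy

theorem mulSub_D_le_left (α : ProductPartialAction k G A) (s t : G) :
    α.D s ⬝ₛ α.D t ≤ α.D s :=
  mulSub_le.2 fun _ hx y _ => α.mul_mem_right s y hx

/-- The skew group algebra `A ⋊_α G = ⨁ D_t δ_t`. -/
def SkewGroupAlgebra (α : ProductPartialAction k G A) : Type (max uG uA) := ⨁ t : G, α.D t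

namespace SkewGroupAlgebra

variable (α : ProductPartialAction k G A)

instance : AddCommGroup α.SkewGroupAlgebra := inferInstanceAs (AddCommGroup (⨁ t : G, α.D t))
instance : Module k α.SkewGroupAlgebra := inferInstanceAs (Module k (⨁ t : G, α.D t))

open scoped Classical in
/-- `a ↦ a δ_t`, for `a ∈ D_t`. -/
def δ (t : G) : α.D t →ₗ[k] α.SkewGroupAlgebra := DirectSum.lof k G (fun t => α.D t) t

/-- `(a, b) ↦ α_r⁻¹ (a) b ∈ D_{r⁻¹}`, for `a ∈ D_r`, `b ∈ D_s`. -/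
def preMul (r s : G) : α.D r →ₗ[k] α.D s →ₗ[k] α.D r⁻¹ :=
  LinearMap.mk₂ k
    (fun a b => ⟨((α.α r).symm a : A) * b, α.mul_mem_right _ _ ((α.α r).symm a).2⟩)
    (fun a a' b => by ext; simp [add_mul])
    (fun c a b => by ext; simp [smul_mul_assoc])
    (fun a b b' => by ext; simp [mul_add])
    (fun c a b => by ext; simp [mul_smul_comm])

/-- `(a, b) ↦ α_r (α_r⁻¹ (a) b) ∈ D_{rs}`, for `a ∈ D_r`, `b ∈ D_s`. -/
def coeffMul (r s : G) : α.D r →ₗ[k] α.D s →ₗ[k] α.D (r * s) :=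
  LinearMap.mk₂ k
    (fun a b => ⟨α.α r (preMul α r s a b),
      α.mulSub_D_le_right _ _ (α.α_mem (t := s) _ (mulSub_mem ((α.α r).symm a).2 b.2))⟩)
    (fun a a' b => by ext; simp)
    (fun c a b => by ext; simp)
    (fun a b b' => by ext; simp)
    (fun c a b => by ext; simp)

theorem coeffMul_apply (r s : G) (a : α.D r) (b : α.D s) (z : α.D r⁻¹)
    (hz : (z : A) = ((α.α r).symm a : A) * b) : (coeffMul α r s a b : A) = α.α r z := by
  have : z = preMul α r s a b := Subtype.ext hz
  rw [this]
  rfl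

open scoped Classical in
/-- The multiplication of `A ⋊_α G` as a bilinear map, determined by
`(a δ_r) (b δ_s) = α_r (α_r⁻¹ (a) b) δ_{rs}`. -/
def mulₗ : α.SkewGroupAlgebra →ₗ[k] α.SkewGroupAlgebra →ₗ[k] α.SkewGroupAlgebra :=
  DirectSum.toModule k G _ fun r => LinearMap.flip
    (DirectSum.toModule k G _ fun s => ((coeffMul α r s).compr₂ (δ α (r * s))).flip)

theorem mulₗ_δ (r s : G) (a : α.D r) (b : α.D s) :
    mulₗ α (δ α r a) (δ α s b) = δ α (r * s) (coeffMul α r s a b) := by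
  unfold mulₗ δ
  erw [DirectSum.toModule_lof, LinearMap.flip_apply, DirectSum.toModule_lof]
  rfl

variable {α} in
theorem induction_δ {p : α.SkewGroupAlgebra → Prop} (x : α.SkewGroupAlgebra) (h0 : p 0)
    (hδ : ∀ t a, p (δ α t a)) (hadd : ∀ x y, p x → p y → p (x + y)) : p x := by
  classical
  refine DirectSum.induction_on x h0 (fun t a => ?_) hadd
  have h : DirectSum.of (fun t => α.D t) t a = δ α t a := by
    unfold δ
    rw [← DirectSum.lof_eq_of k]
    congr!
  have := hδ t a
  rw [← h] at this
  exact this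

theorem δ_congr {s t : G} (h : s = t) {a : α.D s} {b : α.D t} (hab : (a : A) = b) :
    δ α s a = δ α t b := by
  subst h
  rw [Subtype.ext hab]

/-- The identity behind associativity: the left multiplication by `x` and the transported right
multiplication by `c` commute on the idempotent ideal `D_s`. -/
theorem multipliers_commute (s : G) (x c : A) (b : α.D s) (u v : α.D s⁻¹) (xb : α.D s)
    (hxb : (xb : A) = x * b) (hu : (u : A) = ((α.α s).symm xb : A) * c)
    (hv : (v : A) = ((α.α s).symm b : A) * c) :
    (α.α s u : A) = x * α.α s v := by
  -- `R b = α_s (α_s⁻¹ (b) c)`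
  let R : α.D s →ₗ[k] A :=
    { toFun := fun b => α.α s ⟨((α.α s).symm b : A) * c,
        α.mul_mem_right _ _ ((α.α s).symm b).2⟩
      map_add' := fun a b => by
        rw [← Submodule.coe_add, ← map_add]; congr 3; simp [add_mul]
      map_smul' := fun r a => by
        rw [RingHom.id_apply, ← Submodule.coe_smul, ← map_smul]; congr 3
        simp [smul_mul_assoc] }
  have hR : ∀ (b : α.D s) (u : α.D s⁻¹), (u : A) = ((α.α s).symm b : A) * c →
      (α.α s u : A) = R b := by
    intro b u hu
    have : u = ⟨((α.α s).symm b : A) * c, α.mul_mem_right _ _ ((α.α s).symm b).2⟩ :=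
      Subtype.ext hu
    rw [this]; rfl
  rw [hR _ _ hu, hR _ _ hv]
  have hRmul : ∀ p q w : α.D s, (w : A) = p * q → R w = p * R q := by
    intro p q w hw
    have h1 : ((α.α s).symm w : A) = (α.α s).symm p * (α.α s).symm q := by
      let z : α.D s⁻¹ := ⟨((α.α s).symm p : A) * (α.α s).symm q,
        α.mul_mem_right _ _ ((α.α s).symm p).2⟩
      have h2 : α.α s z = w := by
        ext
        rw [α.α_mul s ((α.α s).symm p) ((α.α s).symm q) z rfl]
        simp [hw]
      have h3 : (α.α s).symm w = z := by rw [← h2]; simp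
      rw [h3]
    have h4 := α.α_mul s ((α.α s).symm p) ⟨((α.α s).symm q : A) * c,
        α.mul_mem_right _ _ ((α.α s).symm q).2⟩
        ⟨((α.α s).symm w : A) * c, α.mul_mem_right _ _ ((α.α s).symm w).2⟩
        (by simp [h1, mul_assoc])
    simpa [R] using h4
  have key : ∀ b ∈ α.D s ⬝ₛ α.D s, ∀ b' xb : α.D s, (b' : A) = b → (xb : A) = x * b →
      R xb = x * R b' := by
    let Lx : α.D s →ₗ[k] α.D s :=
      ((LinearMap.mul k A x).comp (α.D s).subtype).codRestrict (α.D s)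
        (fun c => α.mul_mem_left s x c.2)
    have hLx : ∀ b : α.D s, (Lx b : A) = x * b := fun b => rfl
    have hle : α.D s ⬝ₛ α.D s ≤
        (LinearMap.ker (R ∘ₗ Lx - (LinearMap.mul k A x) ∘ₗ R)).map (α.D s).subtype := by
      rw [mulSub_le]
      intro p hp q hq
      refine Submodule.mem_map.2 ⟨⟨p * q, α.mul_mem_left s p hq⟩, ?_, rfl⟩
      rw [LinearMap.mem_ker, LinearMap.sub_apply, sub_eq_zero]
      simp only [LinearMap.comp_apply, LinearMap.mul_apply']
      rw [hRmul ⟨x * p, α.mul_mem_left s x hp⟩ ⟨q, hq⟩ _ (by simp [hLx, mul_assoc]),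
        hRmul ⟨p, hp⟩ ⟨q, hq⟩ ⟨p * q, α.mul_mem_left s p hq⟩ rfl, mul_assoc]
    intro b hb b' xb hb' hxb
    obtain ⟨y, hy, hyb⟩ := Submodule.mem_map.1 (hle hb)
    have hyb' : y = b' := by ext; rw [hb', ← hyb]; rfl
    subst hyb'
    have hL : Lx y = xb := by ext; rw [hLx, hxb, hb']
    rw [LinearMap.mem_ker, LinearMap.sub_apply, sub_eq_zero] at hy
    simpa [hL] using hy
  exact key b (by rw [α.D_idem]; exact b.2) b xb rfl hxb

theorem mulₗ_assoc_δ (r s t : G) (a : α.D r) (b : α.D s) (c : α.D t) :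
    mulₗ α (mulₗ α (δ α r a) (δ α s b)) (δ α t c) =
      mulₗ α (δ α r a) (mulₗ α (δ α s b) (δ α t c)) := by
  rw [mulₗ_δ, mulₗ_δ, mulₗ_δ, mulₗ_δ]
  refine δ_congr α (mul_assoc r s t) ?_
  -- notation: `x = α_r⁻¹ (a)`
  set x : α.D r⁻¹ := (α.α r).symm a with hx
  let xb : α.D s := ⟨x * b, α.mul_mem_left s _ b.2⟩
  let xb' : α.D r⁻¹ := ⟨x * b, α.mul_mem_right _ _ x.2⟩
  have hab : (coeffMul α r s a b : A) = α.α r xb' := coeffMul_apply α r s a b xb' rfl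
  let y : α.D s⁻¹ := (α.α s).symm xb
  -- `y = α_s⁻¹ (x b)` lies in `D_{s⁻¹} D_{(rs)⁻¹}`
  have hymem : (y : A) ∈ α.D s⁻¹ ⬝ₛ α.D (r * s)⁻¹ := by
    have h := α.α_image s (r * s)⁻¹
    have h1 : (xb : A) ∈ α.D s ⬝ₛ α.D (s * (r * s)⁻¹) := by
      have : s * (r * s)⁻¹ = r⁻¹ := by group
      rw [this, α.D_comm]
      exact mulSub_mem x.2 b.2
    rw [← h] at h1
    obtain ⟨z, hz, hzx⟩ := Submodule.mem_map.1 h1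
    have : α.α s z = xb := Subtype.ext hzx
    have hzy : z = y := by simp only [y]; rw [← this]; simp
    rw [← hzy]; exact hz
  let y' : α.D (r * s)⁻¹ := ⟨y, α.mulSub_D_le_right _ _ hymem⟩
  have hy' : (α.α (r * s)).symm (coeffMul α r s a b) = y' := by
    rw [LinearEquiv.symm_apply_eq]
    ext
    rw [hab]
    exact α.α_comp r s y hymem xb' y' (by simp [y, xb, xb']) rfl
  let yc : α.D s⁻¹ := ⟨y * c, α.mul_mem_right _ _ y.2⟩
  let yc' : α.D (r * s)⁻¹ := ⟨y * c, α.mul_mem_right _ _ y'.2⟩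
  have hyc : (yc : A) ∈ α.D s⁻¹ ⬝ₛ α.D (r * s)⁻¹ := by
    have : α.D s⁻¹ ⬝ₛ α.D (r * s)⁻¹ ≤
        (α.D s⁻¹ ⬝ₛ α.D (r * s)⁻¹).comap ((LinearMap.mul k A).flip c) := by
      rw [mulSub_le]
      intro p hp q hq
      simp only [Submodule.mem_comap, LinearMap.flip_apply, LinearMap.mul_apply', mul_assoc]
      exact mulSub_mem hp (α.mul_mem_right _ _ hq)
    exact this hymem
  let v : α.D s⁻¹ := ⟨((α.α s).symm b : A) * c, α.mul_mem_right _ _ ((α.α s).symm b).2⟩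
  have hmc : (α.α s yc : A) = x * α.α s v :=
    multipliers_commute α s x c b yc v xb rfl rfl rfl
  let w : α.D r⁻¹ := ⟨x * α.α s v, α.mul_mem_right _ _ x.2⟩
  rw [coeffMul_apply α (r * s) t _ c yc' (by rw [hy'])]
  rw [coeffMul_apply α r (s * t) a _ w (by
    rw [coeffMul_apply α s t b c v rfl])]
  exact (α.α_comp r s yc hyc w yc' hmc.symm rfl).symm

theorem mulₗ_assoc (x y z : α.SkewGroupAlgebra) :
    mulₗ α (mulₗ α x y) z = mulₗ α x (mulₗ α y z) := by
  induction x using induction_δ with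
  | h0 => simp
  | hadd x x' hx hx' => simp only [map_add, LinearMap.add_apply, hx, hx']
  | hδ r a =>
    induction y using induction_δ with
    | h0 => simp
    | hadd y y' hy hy' => simp only [map_add, LinearMap.add_apply, hy, hy']
    | hδ s b =>
      induction z using induction_δ with
      | h0 => simp
      | hadd z z' hz hz' => simp only [map_add, hz, hz']
      | hδ t c => exact mulₗ_assoc_δ α r s t a b c

instance : NonUnitalRing α.SkewGroupAlgebra where
  mul x y := mulₗ α x y
  left_distrib x y z := (mulₗ α x).map_add y z
  right_distrib x y z := (mulₗ α).map_add₂ x y z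
  zero_mul x := (mulₗ α).map_zero₂ x
  mul_zero x := (mulₗ α x).map_zero
  mul_assoc := mulₗ_assoc α

theorem mul_def (x y : α.SkewGroupAlgebra) : x * y = mulₗ α x y := rfl

instance : IsScalarTower k α.SkewGroupAlgebra α.SkewGroupAlgebra where
  smul_assoc c x y := (mulₗ α).map_smul₂ c x y

instance : SMulCommClass k α.SkewGroupAlgebra α.SkewGroupAlgebra where
  smul_comm c x y := ((mulₗ α x).map_smul c y).symm

theorem δ_mul_δ (r s : G) (a : α.D r) (b : α.D s) :
    δ α r a * δ α s b = δ α (r * s) (coeffMul α r s a b) := mulₗ_δ α r s a b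

open scoped Classical in
theorem isInternal_range_δ :
    DirectSum.IsInternal fun t => LinearMap.range (δ α t) := by
  let dec : α.SkewGroupAlgebra →ₗ[k] ⨁ t : G, LinearMap.range (δ α t) :=
    DirectSum.toModule k G _ fun t =>
      (DirectSum.lof k G (fun t => LinearMap.range (δ α t)) t) ∘ₗ (δ α t).rangeRestrict
  have hdec : ∀ t a, dec (δ α t a) =
      DirectSum.lof k G (fun t => LinearMap.range (δ α t)) t ⟨δ α t a, ⟨a, rfl⟩⟩ := by
    intro t a
    unfold δ
    simp only [dec]
    erw [DirectSum.toModule_lof]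
    rfl
  refine ⟨?_, ?_⟩
  · refine Function.LeftInverse.injective (g := dec) fun x => ?_
    induction x using DirectSum.induction_on with
    | zero => simp
    | add x y hx hy => rw [map_add, map_add, hx, hy]
    | of t a =>
      obtain ⟨_, a, rfl⟩ := a
      rw [DirectSum.coeAddMonoidHom_of, hdec, DirectSum.lof_eq_of]
  · intro x
    induction x using induction_δ with
    | h0 => exact ⟨0, map_zero _⟩
    | hadd x y hx hy =>
      obtain ⟨x', rfl⟩ := hx
      obtain ⟨y', rfl⟩ := hy
      exact ⟨x' + y', map_add _ _ _⟩
    | hδ t a =>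
      exact ⟨DirectSum.of (fun t => LinearMap.range (δ α t)) t ⟨δ α t a, ⟨a, rfl⟩⟩,
        DirectSum.coeAddMonoidHom_of _ _ _⟩

/-- The grading of the skew group algebra, with components `D_t δ_t`. -/
def grading : GroupGrading k G α.SkewGroupAlgebra where
  comp t := LinearMap.range (δ α t)
  isInternal := isInternal_range_δ α
  mul_mem := by
    rintro s t _ _ ⟨a, rfl⟩ ⟨b, rfl⟩
    exact ⟨coeffMul α s t a b, (δ_mul_δ α s t a b).symm⟩

end SkewGroupAlgebra

end ProductPartialAction

/-! ### Restriction of a global action to an idempotent ideal -/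

/-- An action of the group `G` on the `k`-algebra `C` by algebra automorphisms. -/
structure GlobalAction (k : Type uk) (G : Type uG) (C : Type uA) [CommRing k] [Group G]
    [NonUnitalRing C] [Module k C] where
  /-- the group homomorphism `t ↦ β_t` -/
  act : G →* Module.End k C
  act_mul : ∀ t x y, act t (x * y) = act t x * act t y

section Restriction

variable {k : Type uk} [CommRing k] {G : Type uG} [Group G]
  {A : Type uB} [NonUnitalRing A] [Module k A] [IsScalarTower k A A] [SMulCommClass k A A]
  {C : Type uA} [NonUnitalRing C] [Module k C] [IsScalarTower k C C] [SMulCommClass k C C]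

theorem map_mulSub (f : A →ₗ[k] C) (hf : ∀ x y, f (x * y) = f x * f y) (P Q : Submodule k A) :
    (P ⬝ₛ Q).map f = P.map f ⬝ₛ Q.map f := by
  apply le_antisymm
  · rw [Submodule.map_le_iff_le_comap, mulSub_le]
    intro x hx y hy
    rw [Submodule.mem_comap, hf]
    exact mulSub_mem (Submodule.mem_map_of_mem hx) (Submodule.mem_map_of_mem hy)
  · rw [mulSub_le]
    rintro _ ⟨x, hx, rfl⟩ _ ⟨y, hy, rfl⟩
    rw [← hf]
    exact Submodule.mem_map_of_mem (mulSub_mem hx hy)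

namespace GlobalAction

variable (β : GlobalAction k G C)

theorem act_act (s t : G) (x : C) : β.act s (β.act t x) = β.act (s * t) x := by
  rw [map_mul]; rfl

theorem map_act_map_act (s t : G) (P : Submodule k C) :
    (P.map (β.act t)).map (β.act s) = P.map (β.act (s * t)) := by
  rw [← Submodule.map_comp]
  congr 1
  ext x
  exact β.act_act s t x

theorem map_act_one (P : Submodule k C) : P.map (β.act 1) = P := by
  rw [map_one]; exact Submodule.map_id P

/-- The subspace `I β_t(I)` of `C`, for a subalgebra `I` of `C`. -/
def translate (I : NonUnitalSubalgebra k C) (t : G) : Submodule k C :=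
  I.toSubmodule ⬝ₛ I.toSubmodule.map (β.act t)

/-- The conditions on `I ⊆ C` under which `β` restricts to a product partial action on `I`: `I` is
an idempotent two-sided ideal of `C` such that `I β_t(I) = β_t(I) I` for all `t`. -/
structure IsRestrictable (I : NonUnitalSubalgebra k C) : Prop where
  mul_mem_left : ∀ (c : C) {x : C}, x ∈ I → c * x ∈ I
  mul_mem_right : ∀ {x : C} (c : C), x ∈ I → x * c ∈ I
  idem : I.toSubmodule ⬝ₛ I.toSubmodule = I.toSubmodule
  comm : ∀ t : G, I.toSubmodule ⬝ₛ I.toSubmodule.map (β.act t) =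
    I.toSubmodule.map (β.act t) ⬝ₛ I.toSubmodule

variable {β} {I : NonUnitalSubalgebra k C}

namespace IsRestrictable

/-- `β_t(I)`. -/
local notation "Π[" β ", " I ", " t "]" => Submodule.map (GlobalAction.act β t) (NonUnitalSubalgebra.toSubmodule I)

theorem comm' (h : β.IsRestrictable I) (s t : G) :
    Π[β, I, s] ⬝ₛ Π[β, I, t] = Π[β, I, t] ⬝ₛ Π[β, I, s] := by
  have := congrArg (Submodule.map (β.act s)) (h.comm (s⁻¹ * t))
  rw [map_mulSub _ (β.act_mul _), map_mulSub _ (β.act_mul _), β.map_act_map_act,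
    mul_inv_cancel_left] at this
  exact this

theorem idem' (h : β.IsRestrictable I) (t : G) : Π[β, I, t] ⬝ₛ Π[β, I, t] = Π[β, I, t] := by
  rw [← map_mulSub _ (β.act_mul _), h.idem]

theorem translate_le (h : β.IsRestrictable I) (t : G) : β.translate I t ≤ I.toSubmodule :=
  mulSub_le.2 fun _ hx y _ => h.mul_mem_right y hx

theorem translate_mul_translate (h : β.IsRestrictable I) (s t : G) :
    β.translate I s ⬝ₛ β.translate I t = I.toSubmodule ⬝ₛ (Π[β, I, s] ⬝ₛ Π[β, I, t]) := by
  have h1 := h.comm s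
  unfold translate
  rw [mulSub_assoc, ← mulSub_assoc _ I.toSubmodule, ← h1, mulSub_assoc, ← mulSub_assoc, h.idem]

theorem map_translate_inv (h : β.IsRestrictable I) (t : G) :
    (β.translate I t⁻¹).map (β.act t) = β.translate I t := by
  unfold translate
  rw [map_mulSub _ (β.act_mul _), β.map_act_map_act, mul_inv_cancel, β.map_act_one, h.comm]

theorem act_mem (h : β.IsRestrictable I) (t : G) {x : C} (hx : x ∈ β.translate I t⁻¹) :
    β.act t x ∈ β.translate I t := by
  rw [← h.map_translate_inv]; exact Submodule.mem_map_of_mem hx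

theorem translate_mul_mem_left (h : β.IsRestrictable I) (t : G) (c : C) {x : C}
    (hx : x ∈ β.translate I t) : c * x ∈ β.translate I t := by
  have : β.translate I t ≤ (β.translate I t).comap (LinearMap.mul k C c) := by
    conv_lhs => rw [translate]
    rw [mulSub_le]
    intro p hp q hq
    simp only [Submodule.mem_comap, LinearMap.mul_apply', ← mul_assoc]
    exact mulSub_mem (h.mul_mem_left c hp) hq
  exact this hx

theorem translate_mul_mem_right (h : β.IsRestrictable I) (t : G) (c : C) {x : C}
    (hx : x ∈ β.translate I t) : x * c ∈ β.translate I t := by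
  have : β.translate I t ≤ (β.translate I t).comap ((LinearMap.mul k C).flip c) := by
    conv_lhs => rw [translate, h.comm]
    rw [mulSub_le]
    intro p hp q hq
    simp only [Submodule.mem_comap, LinearMap.flip_apply, LinearMap.mul_apply', mul_assoc]
    rw [translate, h.comm]
    exact mulSub_mem hp (h.mul_mem_right c hq)
  exact this hx

end IsRestrictable

/-- The inclusion of the subalgebra `I` of `C`. -/
abbrev incl (I : NonUnitalSubalgebra k C) : I →ₗ[k] C := I.toSubmodule.subtype

theorem incl_injective (I : NonUnitalSubalgebra k C) : Function.Injective (incl I) :=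
  Subtype.val_injective

theorem map_incl_mulSub (P Q : Submodule k I) :
    (P ⬝ₛ Q).map (incl I) = P.map (incl I) ⬝ₛ Q.map (incl I) :=
  map_mulSub _ (fun _ _ => rfl) P Q

theorem IsRestrictable.map_comap (h : β.IsRestrictable I) (t : G) :
    ((β.translate I t).comap (incl I)).map (incl I) = β.translate I t := by
  rw [Submodule.map_comap_eq, inf_eq_right]
  intro x hx
  exact ⟨⟨x, h.translate_le t hx⟩, rfl⟩

theorem eq_of_map_incl_eq {P Q : Submodule k I} (h : P.map (incl I) = Q.map (incl I)) : P = Q :=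
  Submodule.map_injective_of_injective (incl_injective I) h

/-- The restriction of `β` to `I`: the product partial action on the algebra `I` with domains
`D_t = I β_t(I)` and `α_t = β_t` on `D_{t⁻¹}`. -/
def IsRestrictable.restrict (h : β.IsRestrictable I) : ProductPartialAction k G I where
  D t := (β.translate I t).comap (incl I)
  mul_mem_left t a x hx := h.translate_mul_mem_left t a hx
  mul_mem_right t x a hx := h.translate_mul_mem_right t a hx
  α t :=
    { toFun := fun x => ⟨⟨β.act t x.1.1, h.translate_le t (h.act_mem t x.2)⟩, h.act_mem t x.2⟩
      map_add' := fun x y => by ext; simp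
      map_smul' := fun c x => by ext; simp
      invFun := fun x =>
        ⟨⟨β.act t⁻¹ x.1.1, h.translate_le t⁻¹ (h.act_mem t⁻¹ (by rw [inv_inv]; exact x.2))⟩,
          h.act_mem t⁻¹ (by rw [inv_inv]; exact x.2)⟩
      left_inv := fun x => by ext; simp [β.act_act]
      right_inv := fun x => by ext; simp [β.act_act] }
  α_mul t x y z hz := by
    ext
    change β.act t z.1.1 = β.act t x.1.1 * β.act t y.1.1
    rw [hz, ← β.act_mul]
    rfl
  D_one := by
    rw [translate, β.map_act_one, h.idem]
    ext x
    exact iff_of_true x.2 trivial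
  α_one x := by
    ext
    change β.act 1 x.1.1 = x.1.1
    rw [map_one]; rfl
  D_idem t := by
    apply eq_of_map_incl_eq
    rw [map_incl_mulSub, h.map_comap, h.translate_mul_translate, h.idem', translate]
  D_comm s t := by
    apply eq_of_map_incl_eq
    rw [map_incl_mulSub, map_incl_mulSub, h.map_comap, h.map_comap, h.translate_mul_translate,
      h.translate_mul_translate, h.comm']
  α_image s t := by
    apply eq_of_map_incl_eq
    rw [map_incl_mulSub, h.map_comap, h.map_comap, h.translate_mul_translate]
    have key : (β.translate I s⁻¹ ⬝ₛ β.translate I t).map (β.act s) =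
        I.toSubmodule ⬝ₛ (I.toSubmodule.map (β.act s) ⬝ₛ I.toSubmodule.map (β.act (s * t))) := by
      rw [h.translate_mul_translate, map_mulSub _ (β.act_mul _), map_mulSub _ (β.act_mul _),
        β.map_act_map_act, β.map_act_map_act, mul_inv_cancel, β.map_act_one, ← mulSub_assoc,
        ← h.comm, mulSub_assoc]
    rw [← key]
    ext x
    simp only [Submodule.mem_map, Submodule.mem_comap]
    constructor
    · rintro ⟨_, ⟨y, hy, rfl⟩, rfl⟩
      refine ⟨y.1.1, ?_, rfl⟩
      have := Submodule.mem_map_of_mem (f := incl I) hy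
      rw [map_incl_mulSub, h.map_comap, h.map_comap] at this
      exact this
    · rintro ⟨y, hy, rfl⟩
      have hy' := hy
      rw [← h.map_comap s⁻¹, ← h.map_comap t, ← map_incl_mulSub] at hy'
      obtain ⟨z, hz, rfl⟩ := Submodule.mem_map.1 hy'
      have hzs : z ∈ (β.translate I s⁻¹).comap (incl I) :=
        (mulSub_le (R := (β.translate I s⁻¹).comap (incl I))).2
          (fun x hx y _ => h.translate_mul_mem_right s⁻¹ y hx) hz
      exact ⟨_, ⟨⟨z, hzs⟩, hz, rfl⟩, rfl⟩
  α_comp s t x _ y z hy hz := by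
    ext
    change β.act s y.1.1 = β.act (s * t) z.1.1
    rw [hy, hz, ← β.act_act]
    rfl

end GlobalAction

end Restriction

/-! ### Matrices, smash products and the canonical partial action -/

/-- `FMat_G(B)`: the finitely supported `G × G`-matrices over `B`. -/
def FMat (G : Type uG) (B : Type uB) [Zero B] : Type (max uG uB) := G × G →₀ B

namespace FMat

variable {k : Type uk} [CommRing k] {G : Type uG}
  {B : Type uB} [NonUnitalRing B] [Module k B] [IsScalarTower k B B] [SMulCommClass k B B]

instance : AddCommGroup (FMat G B) := inferInstanceAs (AddCommGroup (G × G →₀ B))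
instance : Module k (FMat G B) := inferInstanceAs (Module k (G × G →₀ B))

/-- The `(r, s)`-entry of a matrix. -/
def entry (r s : G) : FMat G B →+ B := Finsupp.applyAddHom (r, s)

/-- The matrix `b e_{r,s}` with only possible non-zero entry `b`, at the position `(r, s)`. -/
def unit (r s : G) : B →+ FMat G B := Finsupp.singleAddHom (r, s)

open scoped Classical in
theorem entry_unit (r s u v : G) (b : B) :
    entry u v (unit r s b) = if r = u ∧ s = v then b else 0 := by
  change (Finsupp.single (r, s) b) (u, v) = _
  rw [Finsupp.single_apply]
  simp [Prod.ext_iff]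

theorem smul_unit (c : k) (r s : G) (b : B) : c • unit r s b = unit r s (c • b) :=
  Finsupp.smul_single c (r, s) b

theorem entry_smul (c : k) (r s : G) (M : FMat G B) : entry r s (c • M) = c • entry r s M := rfl

theorem ext {M N : FMat G B} (h : ∀ r s, entry r s M = entry r s N) : M = N :=
  Finsupp.ext fun p => h p.1 p.2

/-- Every matrix is the sum of its entries. -/
theorem induction_mem {S : G → G → AddSubgroup B} {p : FMat G B → Prop} (M : FMat G B)
    (hM : ∀ r s, entry r s M ∈ S r s) (h0 : p 0) (hadd : ∀ M N, p M → p N → p (M + N))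
    (hu : ∀ r s, ∀ b ∈ S r s, p (unit r s b)) : p M := by
  have : M = Finsupp.sum M fun q b => unit q.1 q.2 b := (Finsupp.sum_single M).symm
  rw [this]
  exact Finset.sum_induction _ p hadd h0 fun q _ => hu _ _ _ (hM q.1 q.2)

@[elab_as_elim]
theorem induction {p : FMat G B → Prop} (M : FMat G B)
    (h0 : p 0) (hadd : ∀ M N, p M → p N → p (M + N))
    (hu : ∀ r s b, p (unit r s b)) : p M :=
  induction_mem (S := fun _ _ => ⊤) M (fun _ _ => trivial) h0 hadd fun r s b _ => hu r s b

open scoped Classical in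
/-- Matrix multiplication, as a biadditive map; it is determined by
`(b e_{r,s}) (c e_{u,v}) = [s = u] b c e_{r,v}`. -/
def mulHom : FMat G B →+ FMat G B →+ FMat G B :=
  Finsupp.liftAddHom fun p => AddMonoidHom.flip (Finsupp.liftAddHom fun q =>
    if p.2 = q.1 then ((AddMonoidHom.mul (R := B)).compr₂ (unit p.1 q.2)).flip else 0)

open scoped Classical in
theorem mulHom_unit (r s u v : G) (b c : B) :
    mulHom (unit r s b) (unit u v c) = if s = u then unit r v (b * c) else 0 := by
  unfold mulHom
  unfold unit
  erw [Finsupp.liftAddHom_apply_single, AddMonoidHom.flip_apply,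
    Finsupp.liftAddHom_apply_single]
  split_ifs <;> rfl

instance : NonUnitalRing (FMat G B) where
  mul M N := mulHom M N
  left_distrib M N P := map_add (mulHom M) N P
  right_distrib M N P := by
    change mulHom (M + N) P = mulHom M P + mulHom N P
    rw [map_add]; rfl
  zero_mul M := by
    change mulHom 0 M = 0
    rw [map_zero]; rfl
  mul_zero M := map_zero (mulHom M)
  mul_assoc M N P := by
    classical
    change mulHom (mulHom M N) P = mulHom M (mulHom N P)
    induction M using induction with
    | h0 => simp
    | hadd M M' h h' => simp only [map_add, AddMonoidHom.add_apply, h, h']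
    | hu r s b =>
      induction N using induction with
      | h0 => simp
      | hadd N N' h h' => simp only [map_add, AddMonoidHom.add_apply, h, h']
      | hu u v c =>
        induction P using induction with
        | h0 => simp
        | hadd P P' h h' => simp only [map_add, h, h']
        | hu w x d =>
          rw [mulHom_unit, mulHom_unit]
          split_ifs with h1 h2 h2
          · rw [mulHom_unit, mulHom_unit, if_pos h1, if_pos h2, mul_assoc]
          · rw [mulHom_unit, if_neg h2, map_zero]
          · rw [mulHom_unit, if_neg h1, map_zero]; rfl
          · simp

open scoped Classical in
theorem unit_mul_unit (r s u v : G) (b c : B) :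
    unit r s b * unit u v c = if s = u then unit r v (b * c) else 0 := mulHom_unit r s u v b c

/-- The entries of a product are given by the usual formula. -/
theorem entry_mul (M N : FMat G B) (r s : G) :
    entry r s (M * N) = ∑ᶠ w : G, entry r w M * entry w s N := by
  classical
  have hfin : ∀ M N : FMat G B, (Function.support fun w => entry r w M * entry w s N).Finite := by
    intro M N
    refine ((Finsupp.hasFiniteSupport M).image Prod.snd).subset fun w hw => ?_
    refine ⟨(r, w), fun h0 => hw ?_, rfl⟩
    have h0' : entry r w M = 0 := h0
    simp [h0']
  induction M using induction with
  | h0 => simp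
  | hadd M M' h h' =>
    simp only [add_mul, map_add, h, h']
    rw [finsum_add_distrib (hfin _ _) (hfin _ _)]
  | hu u v b =>
    induction N using induction with
    | h0 => simp
    | hadd N N' h h' =>
      simp only [mul_add, map_add, h, h']
      rw [finsum_add_distrib (hfin _ _) (hfin _ _)]
    | hu x y c =>
      rw [unit_mul_unit, finsum_eq_single _ v]
      · simp only [entry_unit]
        split_ifs <;> simp_all [entry_unit]
      · intro w hw
        simp [entry_unit, hw.symm]

instance : IsScalarTower k (FMat G B) (FMat G B) where
  smul_assoc c M N := by
    classical
    simp only [smul_eq_mul]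
    induction M using induction with
    | h0 => simp
    | hadd M M' h h' => simp only [smul_add, add_mul, h, h']
    | hu r s b =>
      induction N using induction with
      | h0 => simp
      | hadd N N' h h' => simp only [mul_add, smul_add, h, h']
      | hu u v d =>
        rw [smul_unit, unit_mul_unit, unit_mul_unit]
        split_ifs
        · rw [smul_unit, smul_mul_assoc]
        · simp

instance : SMulCommClass k (FMat G B) (FMat G B) where
  smul_comm c M N := by
    classical
    simp only [smul_eq_mul]
    induction M using induction with
    | h0 => simp
    | hadd M M' h h' => simp only [smul_add, add_mul, h, h']
    | hu r s b =>
      induction N using induction with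
      | h0 => simp
      | hadd N N' h h' => simp only [mul_add, smul_add, h, h']
      | hu u v d =>
        rw [smul_unit, unit_mul_unit, unit_mul_unit]
        split_ifs
        · rw [smul_unit, mul_smul_comm]
        · simp

end FMat

section Smash

variable {k : Type uk} [CommRing k] {G : Type uG} [Group G]
  {B : Type uB} [NonUnitalRing B] [Module k B] [IsScalarTower k B B] [SMulCommClass k B B]
  (ℬ : GroupGrading k G B)

theorem FMat.entry_mul_mem (P : Submodule k B) (M N : FMat G B) (r s : G)
    (h : ∀ w, FMat.entry r w M * FMat.entry w s N ∈ P) : FMat.entry r s (M * N) ∈ P := by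
  rw [FMat.entry_mul]
  exact finsum_induction (· ∈ P) P.zero_mem (fun _ _ => P.add_mem) h

/-- The smash product `B # G = ⨁ B_{r⁻¹s} e_{r,s} ⊆ FMat_G(B)`. -/
def smash : NonUnitalSubalgebra k (FMat G B) where
  carrier := {M | ∀ r s, FMat.entry r s M ∈ ℬ.comp (r⁻¹ * s)}
  add_mem' hM hN r s := by rw [map_add]; exact add_mem (hM r s) (hN r s)
  zero_mem' r s := by rw [map_zero]; exact zero_mem _
  smul_mem' c M hM r s := by rw [FMat.entry_smul]; exact Submodule.smul_mem _ c (hM r s)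
  mul_mem' {M N} hM hN r s := FMat.entry_mul_mem _ M N r s fun w => by
    have := ℬ.mul_mem (hM r w) (hN w s)
    rwa [mul_assoc, mul_inv_cancel_left] at this

/-- The partial smash product `I^B = ⨁ B_{r⁻¹} B_s e_{r,s} ⊆ B # G`. -/
def partialSmash : NonUnitalSubalgebra k (smash ℬ) where
  carrier := {M | ∀ r s, FMat.entry r s M.1 ∈ ℬ.comp r⁻¹ ⬝ₛ ℬ.comp s}
  add_mem' hM hN r s := by
    change FMat.entry r s (_ + _) ∈ _
    rw [map_add]; exact add_mem (hM r s) (hN r s)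
  zero_mem' r s := by
    change FMat.entry r s 0 ∈ _
    rw [map_zero]; exact zero_mem _
  smul_mem' c M hM r s := Submodule.smul_mem _ c (hM r s)
  mul_mem' {M N} hM _ r s := FMat.entry_mul_mem _ M.1 N.1 r s fun w => by
    have h := mulSub_mem (hM r w) (N.2 w s)
    rw [mulSub_assoc] at h
    exact mulSub_mono le_rfl (ℬ.mulSub_comp_le' (by group)) h

variable (k G B) in
/-- The action `(t · M)(r, s) = M(t⁻¹ r, t⁻¹ s)` on matrices, `t · b e_{r,s} = b e_{tr,ts}`. -/
def FMat.translate (t : G) : FMat G B →ₗ[k] FMat G B :=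
  Finsupp.lmapDomain B k fun p : G × G => (t * p.1, t * p.2)

theorem FMat.translate_unit (t r s : G) (b : B) :
    FMat.translate k G B t (FMat.unit r s b) = FMat.unit (t * r) (t * s) b :=
  Finsupp.mapDomain_single

theorem FMat.entry_translate (t r s : G) (M : FMat G B) :
    FMat.entry r s (FMat.translate k G B t M) = FMat.entry (t⁻¹ * r) (t⁻¹ * s) M := by
  have hinj : Function.Injective fun p : G × G => (t * p.1, t * p.2) := by
    rintro ⟨a, b⟩ ⟨c, d⟩ h
    simpa using h
  have := Finsupp.mapDomain_apply hinj M (t⁻¹ * r, t⁻¹ * s)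
  simp only [mul_inv_cancel_left] at this
  exact this

theorem FMat.translate_mul (t : G) (M N : FMat G B) :
    FMat.translate k G B t (M * N) = FMat.translate k G B t M * FMat.translate k G B t N := by
  apply FMat.ext
  intro r s
  rw [FMat.entry_translate, FMat.entry_mul, FMat.entry_mul]
  refine (finsum_comp_equiv (Equiv.mulLeft t⁻¹)).symm.trans ?_
  simp only [FMat.entry_translate]
  rfl

/-- The dual action `β^B` of `G` on `B # G`. -/
def dualAction : GlobalAction k G (smash ℬ) where
  act :=
    { toFun := fun t => (FMat.translate k G B t).restrict (p := (smash ℬ).toSubmodule)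
        (q := (smash ℬ).toSubmodule) fun M hM r s => by
          rw [FMat.entry_translate]
          have := hM (t⁻¹ * r) (t⁻¹ * s)
          rwa [mul_inv_rev, inv_inv, mul_assoc, mul_inv_cancel_left] at this
      map_one' := by
        ext M : 2
        apply FMat.ext
        intro r s
        change FMat.entry r s (FMat.translate k G B 1 M.1) = FMat.entry r s M.1
        rw [FMat.entry_translate]; simp
      map_mul' := fun t u => by
        ext M : 2
        apply FMat.ext
        intro r s
        change FMat.entry r s (FMat.translate k G B (t * u) M.1) =
          FMat.entry r s (FMat.translate k G B t (FMat.translate k G B u M.1))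
        simp only [FMat.entry_translate, mul_inv_rev, mul_assoc] }
  act_mul t M N := Subtype.ext (FMat.translate_mul (k := k) t M.1 N.1)

theorem entry_dualAction (t r s : G) (M : smash ℬ) :
    FMat.entry r s ((dualAction ℬ).act t M).1 = FMat.entry (t⁻¹ * r) (t⁻¹ * s) M.1 :=
  FMat.entry_translate (k := k) t r s M.1

variable {ℬ}

namespace GroupGrading.IsPartiallyStronglyGraded

theorem one_mul (h : ℬ.IsPartiallyStronglyGraded) (t : G) :
    ℬ.comp t ≤ ℬ.comp 1 ⬝ₛ ℬ.comp t := by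
  conv_lhs => rw [h t]
  exact mulSub_mono (ℬ.mulSub_comp_le' (mul_inv_cancel t)) le_rfl

end GroupGrading.IsPartiallyStronglyGraded

/-- The matrices of `B # G` with entries in prescribed submodules. -/
def matIn (S : G → G → Submodule k B) : Submodule k (smash ℬ) where
  carrier := {M | ∀ r s, FMat.entry r s M.1 ∈ S r s}
  add_mem' hM hN r s := by
    change FMat.entry r s (_ + _) ∈ _
    rw [map_add]; exact add_mem (hM r s) (hN r s)
  zero_mem' r s := by
    change FMat.entry r s 0 ∈ _
    rw [map_zero]; exact zero_mem _
  smul_mem' c M hM r s := Submodule.smul_mem _ c (hM r s)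

/-- The submodule of all `b` such that `b e_{r,s}` lies in `P ⊆ B # G`. -/
def unitIn (P : Submodule k (smash ℬ)) (r s : G) : Submodule k B where
  carrier := {b | ∃ M ∈ P, M.1 = FMat.unit r s b}
  add_mem' := by
    rintro b c ⟨M, hM, h⟩ ⟨N, hN, h'⟩
    exact ⟨M + N, P.add_mem hM hN, by rw [map_add, ← h, ← h']; rfl⟩
  zero_mem' := ⟨0, P.zero_mem, by rw [map_zero]; rfl⟩
  smul_mem' := by
    rintro c b ⟨M, hM, h⟩
    exact ⟨c • M, P.smul_mem c hM, by rw [← FMat.smul_unit, ← h]; rfl⟩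

theorem matIn_le (S : G → G → Submodule k B) (P : Submodule k (smash ℬ))
    (hP : ∀ r s, S r s ≤ unitIn P r s) : matIn S ≤ P := by
  intro M hM
  have : ∃ M' ∈ P, M'.1 = M.1 := by
    refine FMat.induction_mem (S := fun r s => (S r s).toAddSubgroup) M.1 hM
      (p := fun N => ∃ M' ∈ P, M'.1 = N) ⟨0, P.zero_mem, rfl⟩ ?_ hP
    rintro _ _ ⟨M, hM, rfl⟩ ⟨N, hN, rfl⟩
    exact ⟨M + N, P.add_mem hM hN, rfl⟩
  obtain ⟨M', hM', h⟩ := this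
  rwa [← Subtype.ext h]

open scoped Classical in
theorem unit_mem {S : G → G → Submodule k B} {r s : G} {b : B} (hb : b ∈ S r s) (u v : G) :
    FMat.entry u v (FMat.unit r s b) ∈ S u v := by
  rw [FMat.entry_unit]
  split_ifs with h
  · obtain ⟨rfl, rfl⟩ := h; exact hb
  · exact zero_mem _

/-- If `P` and `Q` contain all matrices of `B # G` with entries in `S`, respectively in `T`, then
`(S r w T w s) e_{r,s} ⊆ P Q`. -/
theorem mulSub_le_unitIn (S T : G → G → Submodule k B) (P Q : Submodule k (smash ℬ))
    (hS : ∀ r s, S r s ≤ ℬ.comp (r⁻¹ * s)) (hT : ∀ r s, T r s ≤ ℬ.comp (r⁻¹ * s))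
    (hP : matIn S ≤ P) (hQ : matIn T ≤ Q) (r w s : G) :
    S r w ⬝ₛ T w s ≤ unitIn (P ⬝ₛ Q) r s := by
  classical
  rw [mulSub_le]
  intro b hb c hc
  let M : smash ℬ := ⟨FMat.unit r w b, unit_mem (S := fun r s => ℬ.comp (r⁻¹ * s)) (hS _ _ hb)⟩
  let N : smash ℬ := ⟨FMat.unit w s c, unit_mem (S := fun r s => ℬ.comp (r⁻¹ * s)) (hT _ _ hc)⟩
  refine ⟨M * N, mulSub_mem (hP (unit_mem (S := S) hb)) (hQ (unit_mem (S := T) hc)), ?_⟩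
  change FMat.unit r w b * FMat.unit w s c = _
  rw [FMat.unit_mul_unit, if_pos rfl]

theorem partialSmash_eq_matIn :
    (partialSmash ℬ).toSubmodule = matIn fun r s => ℬ.comp r⁻¹ ⬝ₛ ℬ.comp s := rfl

theorem map_partialSmash (t : G) :
    (partialSmash ℬ).toSubmodule.map ((dualAction ℬ).act t) =
      matIn fun r s => ℬ.comp (r⁻¹ * t) ⬝ₛ ℬ.comp (t⁻¹ * s) := by
  ext M
  constructor
  · rintro ⟨N, hN, rfl⟩ r s
    rw [entry_dualAction]
    have := hN (t⁻¹ * r) (t⁻¹ * s)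
    rwa [mul_inv_rev, inv_inv] at this
  · intro hM
    refine ⟨(dualAction ℬ).act t⁻¹ M, fun r s => ?_, ?_⟩
    · rw [entry_dualAction, inv_inv]
      have : FMat.entry (t * r) (t * s) M.1 ∈
          ℬ.comp ((t * r)⁻¹ * t) ⬝ₛ ℬ.comp (t⁻¹ * (t * s)) := hM (t * r) (t * s)
      rwa [mul_inv_rev, inv_mul_cancel_right, inv_mul_cancel_left] at this
    · rw [GlobalAction.act_act, mul_inv_cancel, map_one]; rfl

theorem matIn_mulSub_matIn_le (S T U : G → G → Submodule k B)
    (h : ∀ r w s, S r w ⬝ₛ T w s ≤ U r s) :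
    (matIn S : Submodule k (smash ℬ)) ⬝ₛ matIn T ≤ matIn U :=
  mulSub_le.2 fun M hM N hN r s =>
    FMat.entry_mul_mem _ M.1 N.1 r s fun w => h r w s (mulSub_mem (hM r w) (hN w s))

/-- For partially-strongly-graded `B`, the partial smash product is an idempotent ideal of `B # G`
with `I β_t(I) = β_t(I) I`. -/
theorem partialSmash_isRestrictable (h : ℬ.IsPartiallyStronglyGraded) :
    (dualAction ℬ).IsRestrictable (partialSmash ℬ) := by
  have hS : ∀ r s, ℬ.comp r⁻¹ ⬝ₛ ℬ.comp s ≤ ℬ.comp (r⁻¹ * s) := fun r s => ℬ.mulSub_comp_le _ _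
  have hT : ∀ t r s, ℬ.comp (r⁻¹ * t) ⬝ₛ ℬ.comp (t⁻¹ * s) ≤ ℬ.comp (r⁻¹ * s) := fun t r s =>
    ℬ.mulSub_comp_le' (by group)
  have hone : ∀ t, ℬ.comp t ≤ ℬ.comp t ⬝ₛ ℬ.comp 1 := fun t => by
    conv_lhs => rw [h t, mulSub_assoc]
    exact mulSub_mono le_rfl (ℬ.mulSub_comp_le' (inv_mul_cancel t))
  -- both products consist of the matrices with entries in `B_{r⁻¹} B_t B_{t⁻¹} B_s`
  have key1 : ∀ t,
      (partialSmash ℬ).toSubmodule ⬝ₛ (partialSmash ℬ).toSubmodule.map ((dualAction ℬ).act t) =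
        matIn fun r s => ℬ.comp r⁻¹ ⬝ₛ (ℬ.comp t ⬝ₛ (ℬ.comp t⁻¹ ⬝ₛ ℬ.comp s)) := by
    intro t
    rw [map_partialSmash, partialSmash_eq_matIn]
    apply le_antisymm
    · refine matIn_mulSub_matIn_le _ _ _ fun r w s => ?_
      rw [mulSub_assoc, ← mulSub_assoc (ℬ.comp w)]
      refine mulSub_mono le_rfl ((mulSub_mono (ℬ.mulSub_comp_le' (u := t) (by group)) le_rfl).trans ?_)
      conv_lhs => rw [h t, mulSub_assoc, mulSub_assoc]
      exact mulSub_mono le_rfl (mulSub_mono le_rfl (ℬ.mulSub_comp_le' (by group)))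
    · refine matIn_le _ _ fun r s => le_trans ?_
        (mulSub_le_unitIn _ _ _ _ hS (hT t) le_rfl le_rfl r 1 s)
      rw [inv_one, _root_.one_mul]
      exact mulSub_mono (hone _) (mulSub_mono le_rfl (ℬ.mulSub_comp_le _ _))
  have key2 : ∀ t,
      (partialSmash ℬ).toSubmodule.map ((dualAction ℬ).act t) ⬝ₛ (partialSmash ℬ).toSubmodule =
        matIn fun r s => ℬ.comp r⁻¹ ⬝ₛ (ℬ.comp t ⬝ₛ (ℬ.comp t⁻¹ ⬝ₛ ℬ.comp s)) := by
    intro t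
    rw [map_partialSmash, partialSmash_eq_matIn]
    apply le_antisymm
    · refine matIn_mulSub_matIn_le _ _ _ fun r w s => ?_
      simp only [← mulSub_assoc]
      refine mulSub_mono ?_ le_rfl
      rw [mulSub_assoc _ (ℬ.comp (t⁻¹ * w))]
      refine (mulSub_mono le_rfl (ℬ.mulSub_comp_le' (u := t⁻¹) (by group))).trans ?_
      conv_lhs => rw [h t⁻¹, inv_inv]
      simp only [← mulSub_assoc]
      refine mulSub_mono ?_ le_rfl
      refine mulSub_mono ?_ le_rfl
      exact ℬ.mulSub_comp_le' (by group)
    · refine matIn_le _ _ fun r s => le_trans ?_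
        (mulSub_le_unitIn _ _ _ _ (hT t) hS le_rfl le_rfl r 1 s)
      rw [inv_one, _root_.mul_one, ← mulSub_assoc, ← mulSub_assoc, mulSub_assoc]
      rw [← mulSub_assoc]
      exact mulSub_mono (mulSub_mono (ℬ.mulSub_comp_le _ _) le_rfl) (h.one_mul s)
  refine ⟨fun c x hx r s => ?_, fun c hx r s => ?_, ?_, fun t => ?_⟩
  · refine FMat.entry_mul_mem _ _ _ r s fun w => ?_
    have := mulSub_mem (c.2 r w) (hx w s)
    rw [← mulSub_assoc] at this
    exact mulSub_mono (ℬ.mulSub_comp_le' (by group)) le_rfl this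
  · refine FMat.entry_mul_mem _ _ _ r s fun w => ?_
    have := mulSub_mem (hx r w) (c.2 w s)
    rw [mulSub_assoc] at this
    exact mulSub_mono le_rfl (ℬ.mulSub_comp_le' (by group)) this
  · have h1 : (partialSmash ℬ).toSubmodule.map ((dualAction ℬ).act 1) =
        (partialSmash ℬ).toSubmodule := (dualAction ℬ).map_act_one _
    have h2 := key1 1
    rw [h1] at h2
    rw [h2, partialSmash_eq_matIn]
    ext M
    constructor
    · intro hM r s
      refine mulSub_mono le_rfl ?_ (hM r s)
      rw [inv_one]
      exact (mulSub_mono le_rfl (ℬ.mulSub_comp_le' (_root_.one_mul s))).trans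
        (ℬ.mulSub_comp_le' (_root_.one_mul s))
    · intro hM r s
      refine mulSub_mono le_rfl ?_ (hM r s)
      rw [inv_one]
      exact (h.one_mul s).trans (mulSub_mono le_rfl (h.one_mul s))
  · rw [key1, key2]

/-- The canonical partial action `γ^B` of `G` on the partial smash product `I^B`: the restriction
of the dual action `β^B` to `I^B`. -/
def canonicalPartialAction (h : ℬ.IsPartiallyStronglyGraded) :
    ProductPartialAction k G (partialSmash ℬ) :=
  (partialSmash_isRestrictable h).restrict

end Smash
end

/-! Both graded algebras embed in the algebra of finitely supported `G × G`-matrices over `B`. The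
equivalence is then the familiar one between a matrix algebra and its corner at position `(1, 1)`,
with the first row and the first column as bimodules.

`B` is embedded by `b ↦ b e_{1,1}`. For the skew group algebra, consider the formal permutation
matrices `U_t = ∑_w e_{tw,w}`. The dual action is conjugation by `U_t`, so `M δ_t ↦ M U_t` is
multiplicative (`FMat.shift_mul_shift`, `skewToMatrix_mul`). The domain `D_t` of the canonical
partial action consists of the matrices with `(r, s)`-entry in `B_{r⁻¹} B_t B_{t⁻¹} B_s`. Right
multiplication by `U_t` moves column `ts` to column `s`, and `B_t B_{t⁻¹} B_{ts} = B_t B_s`, so the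
image of degree `t` has entries in `B_{r⁻¹} B_t B_s` (`map_skewToMatrix_comp`). These entries have
degree `r⁻¹ts`, which determines `t` once `r` and `s` are fixed. Hence the images are independent
(`iSupIndep_corner`) and the map is injective.

Now the degree-`t` parts of `B`, of the row bimodule, of the column bimodule and of the skew group
algebra are all of the form `corner ℬ P Q (ℬ.comp t)` with `P` and `Q` equal to `{1}` or `G`. Such
corners multiply by multiplying the middle submodules, whatever the intermediate index set
containing `1` is (`corner_mulSub_corner`). Every condition of the equivalence thus reduces to `B_s
B_t ⊆ B_{st}`, `B_t B_1 = B_t` or `B_t B_{t⁻¹} B_t = B_t`. The compatibilities of the Morita context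
are associativity of matrix multiplication (`stronglyGradedEquivalent_of_embedding`). -/

noncomputable section

universe uk uG uA uB uX uY

/-! ### Independent families of submodules -/

section Independence

variable {k ι κ M N : Type*} [CommRing k] [AddCommGroup M] [Module k M] [AddCommGroup N]
  [Module k N]

/-- Independence of submodules can be tested after applying a jointly injective family of linear
maps. -/
theorem iSupIndep_of_jointly_injective {P : ι → Submodule k M} {P' : κ → ι → Submodule k N}
    (f : κ → M →ₗ[k] N) (hf : ∀ x, (∀ i, f i x = 0) → x = 0) (hP' : ∀ i, iSupIndep (P' i))
    (h : ∀ i t, P t ≤ (P' i t).comap (f i)) : iSupIndep P := by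
  intro t
  rw [Submodule.disjoint_def]
  intro x hx hx'
  refine hf x fun i => ?_
  refine (Submodule.disjoint_def.1 (hP' i t)) _ (h i t hx) ?_
  have hle : (⨆ (j) (_ : j ≠ t), P j) ≤ (⨆ (j) (_ : j ≠ t), P' i j).comap (f i) :=
    iSup₂_le fun j hj => (h i j).trans
      (Submodule.comap_mono (le_iSup₂ (f := fun j (_ : j ≠ t) => P' i j) j hj))
  exact hle hx'

/-- This supplies the grading of a bimodule constructed as a sum of independent submodules of an
ambient algebra. Independence and spanning are both checked after the inclusion into `M`. -/
theorem isInternal_comap_subtype_iSup [DecidableEq ι] {P : ι → Submodule k M}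
    (hP : iSupIndep P) :
    DirectSum.IsInternal fun t => (P t).comap (⨆ t, P t).subtype := by
  refine DirectSum.isInternal_submodule_of_iSupIndep_of_iSup_eq_top ?_ ?_
  · exact iSupIndep_of_jointly_injective (κ := Unit) (P' := fun _ => P)
      (fun _ => (⨆ t, P t).subtype) (fun x hx => Subtype.ext (hx ())) (fun _ => hP)
      fun _ _ => le_rfl
  · refine Submodule.map_injective_of_injective (Submodule.subtype_injective _) ?_
    simp only [Submodule.map_iSup, Submodule.map_comap_eq, Submodule.range_subtype,
      Submodule.map_top]
    exact iSup_congr fun t => inf_eq_right.2 (le_iSup P t)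

/-- The map factors through the direct sum of the ranges. The first factor is injective
componentwise, the second because the ranges are independent. -/
theorem toModule_injective [DecidableEq ι] {E : ι → Type*} [∀ t, AddCommGroup (E t)]
    [∀ t, Module k (E t)] (f : ∀ t, E t →ₗ[k] N) (hf : ∀ t, Function.Injective (f t))
    (hind : iSupIndep fun t => LinearMap.range (f t)) :
    Function.Injective (DirectSum.toModule k ι N f) := by
  have h : DirectSum.toModule k ι N f =
      DFinsupp.lsum ℕ (fun t => (LinearMap.range (f t)).subtype) ∘ₗ
        DFinsupp.mapRange.linearMap fun t => (f t).rangeRestrict := by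
    refine DirectSum.linearMap_ext _ fun t => LinearMap.ext fun x => ?_
    have hx : DFinsupp.mapRange.linearMap (fun t => (f t).rangeRestrict)
        (DirectSum.lof k ι E t x) = DFinsupp.single t ((f t).rangeRestrict x) :=
      DFinsupp.mapRange_single (hf := fun _ => map_zero _)
    rw [LinearMap.comp_apply, DirectSum.toModule_lof, LinearMap.comp_apply, LinearMap.comp_apply]
    erw [hx, DFinsupp.lsum_single]
    rfl
  rw [h, LinearMap.coe_comp]
  refine hind.dfinsupp_lsum_injective.comp ?_
  refine (DFinsupp.mapRange_injective _ fun t => map_zero _).2 fun t => ?_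
  intro x y hxy
  exact hf t (congrArg Subtype.val hxy)

end Independence

/-! ### Graded Morita contexts inside an algebra -/

section Embedded

variable {k : Type uk} [CommRing k] {G : Type uG} [Group G]
  {A : Type uA} [NonUnitalRing A] [Module k A] [IsScalarTower k A A] [SMulCommClass k A A]
  {B : Type uB} [NonUnitalRing B] [Module k B] [IsScalarTower k B B] [SMulCommClass k B B]
  {R : Type uX} [NonUnitalRing R] [Module k R] [IsScalarTower k R R] [SMulCommClass k R R]
  {𝒜 : GroupGrading k G A} {ℬ : GroupGrading k G B}

/-- Products distribute over suprema. This makes actions and pairings, controlled only on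
homogeneous parts, well defined on the total sums. -/
theorem mulSub_iSup_le {a P Q : G → Submodule k R} (h : ∀ s t, a s ⬝ₛ P t ≤ Q (s * t)) :
    (⨆ s, a s) ⬝ₛ (⨆ t, P t) ≤ ⨆ t, Q t := by
  unfold mulSub at *
  rw [Submodule.map₂_iSup_left]
  refine iSup_le fun s => ?_
  rw [Submodule.map₂_iSup_right]
  exact iSup_le fun t => (h s t).trans (le_iSup Q (s * t))

namespace GroupGrading

open scoped Classical in
theorem iSup_comp (𝒜 : GroupGrading k G A) : ⨆ t, 𝒜.comp t = ⊤ :=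
  𝒜.isInternal.submodule_iSup_eq_top

theorem iSup_map_comp (𝒜 : GroupGrading k G A) (φ : A →ₗ[k] R) :
    ⨆ t, (𝒜.comp t).map φ = LinearMap.range φ := by
  rw [← Submodule.map_iSup, 𝒜.iSup_comp, Submodule.map_top]

theorem apply_mem_iSup_map_comp (𝒜 : GroupGrading k G A) (φ : A →ₗ[k] R) (a : A) :
    φ a ∈ ⨆ t, (𝒜.comp t).map φ := by
  rw [iSup_map_comp]; exact ⟨a, rfl⟩

namespace IsPartiallyStronglyGraded

/-- Each `A_t = (A_t A_{t⁻¹}) A_t` already lies in `A A`, and the `A_t` span `A`. -/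
theorem isIdempotentAlgebra (h : 𝒜.IsPartiallyStronglyGraded) : IsIdempotentAlgebra k A := by
  refine eq_top_iff.2 ?_
  rw [← 𝒜.iSup_comp]
  refine iSup_le fun t => ?_
  rw [h t]
  exact mulSub_mono (by rw [𝒜.iSup_comp]; exact le_top) (le_iSup _ t)

theorem ideal_idem (h : 𝒜.IsPartiallyStronglyGraded) (t : G) :
    𝒜.ideal t ⬝ₛ 𝒜.ideal t = 𝒜.ideal t := by
  unfold GroupGrading.ideal
  rw [← mulSub_assoc, ← h t]

/-- Taking images under an injective multiplicative map is injective on submodules and commutes with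
their products, so the condition can be verified inside `R`. -/
theorem of_map (φ : A →ₗ[k] R) (hφ : ∀ x y, φ (x * y) = φ x * φ y) (hinj : Function.Injective φ)
    (h : ∀ t, (𝒜.comp t).map φ =
      (𝒜.comp t).map φ ⬝ₛ (𝒜.comp t⁻¹).map φ ⬝ₛ (𝒜.comp t).map φ) :
    𝒜.IsPartiallyStronglyGraded := fun t =>
  Submodule.map_injective_of_injective hinj (by
    rw [map_mulSub _ hφ, map_mulSub _ hφ]; exact h t)

end IsPartiallyStronglyGraded

end GroupGrading

open scoped Classical in
/-- The graded bimodule `⨆ P_t ⊆ R` over graded algebras `A`, `B` mapping to `R`. -/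
def GradedBimodule.ofSubmodules (φ : A →ₗ[k] R) (hφ : ∀ x y, φ (x * y) = φ x * φ y)
    (ψ : B →ₗ[k] R) (hψ : ∀ x y, ψ (x * y) = ψ x * ψ y) (P : G → Submodule k R)
    (hP : iSupIndep P) (hl : ∀ s t, (𝒜.comp s).map φ ⬝ₛ P t ≤ P (s * t))
    (hr : ∀ s t, P s ⬝ₛ (ℬ.comp t).map ψ ≤ P (s * t)) :
    GradedBimodule.{uk, uG, uA, uB, uX} 𝒜 ℬ where
  carrier := ↥(⨆ t, P t)
  left := LinearMap.mk₂ k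
    (fun a x => ⟨φ a * x, mulSub_iSup_le hl
      (mulSub_mem (𝒜.apply_mem_iSup_map_comp φ a) x.2)⟩)
    (fun a a' x => by ext; simp [add_mul]) (fun c a x => by ext; simp [smul_mul_assoc])
    (fun a x x' => by ext; simp [mul_add]) (fun c a x => by ext; simp [mul_smul_comm])
  right := LinearMap.mk₂ k
    (fun x b => ⟨x * ψ b, mulSub_iSup_le hr
      (mulSub_mem x.2 (ℬ.apply_mem_iSup_map_comp ψ b))⟩)
    (fun a a' x => by ext; simp [add_mul]) (fun c a x => by ext; simp [smul_mul_assoc])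
    (fun a x x' => by ext; simp [mul_add]) (fun c a x => by ext; simp [mul_smul_comm])
  left_mul a a' x := by ext; simp [hφ, mul_assoc]
  right_mul x b b' := by ext; simp [hψ, mul_assoc]
  left_right a x b := by ext; simp [mul_assoc]
  comp t := (P t).comap (⨆ t, P t).subtype
  isInternal := isInternal_comap_subtype_iSup hP
  left_mem ha hx := hl _ _ (mulSub_mem (Submodule.mem_map_of_mem ha) hx)
  right_mem hx hb := hr _ _ (mulSub_mem hx (Submodule.mem_map_of_mem hb))

/-- For a pairing `m` that becomes the multiplication of `R` after `φ`, this turns statements about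
the images of `τ_A` and `τ_B` into statements about products of submodules of `R`. -/
theorem map_map₂_subtype {P Q : Submodule k R} (m : P →ₗ[k] Q →ₗ[k] A) (φ : A →ₗ[k] R)
    (hm : ∀ x y, φ (m x y) = x * y) {P' Q' : Submodule k R} (hP : P' ≤ P) (hQ : Q' ≤ Q) :
    (Submodule.map₂ m (P'.comap P.subtype) (Q'.comap Q.subtype)).map φ = P' ⬝ₛ Q' := by
  apply le_antisymm
  · rw [Submodule.map_le_iff_le_comap, Submodule.map₂_le]
    intro x hx y hy
    rw [Submodule.mem_comap, hm]
    exact mulSub_mem hx hy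
  · rw [mulSub_le]
    intro x hx y hy
    rw [← hm ⟨x, hP hx⟩ ⟨y, hQ hy⟩]
    exact Submodule.mem_map_of_mem (Submodule.apply_mem_map₂ m
      (show (⟨x, hP hx⟩ : P) ∈ P'.comap P.subtype from hx) hy)

/-- The multiplication `P × Q → R`, for `P Q` in the image of the injective map `φ : A → R`. -/
def mulInto (φ : A →ₗ[k] R) (hinj : Function.Injective φ) {P Q : Submodule k R}
    (h : P ⬝ₛ Q ≤ LinearMap.range φ) : P →ₗ[k] Q →ₗ[k] A :=
  LinearMap.mk₂ k
    (fun x y => (LinearEquiv.ofInjective φ hinj).symm ⟨x * y, h (mulSub_mem x.2 y.2)⟩)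
    (fun x x' y => by rw [← map_add]; congr 1; ext; simp [add_mul])
    (fun c x y => by rw [← map_smul]; congr 1; ext; simp [smul_mul_assoc])
    (fun x y y' => by rw [← map_add]; congr 1; ext; simp [mul_add])
    (fun c x y => by rw [← map_smul]; congr 1; ext; simp [mul_smul_comm])

theorem apply_mulInto (φ : A →ₗ[k] R) (hinj : Function.Injective φ) {P Q : Submodule k R}
    (h : P ⬝ₛ Q ≤ LinearMap.range φ) (x : P) (y : Q) : φ (mulInto φ hinj h x y) = x * y :=
  congrArg Subtype.val
    ((LinearEquiv.ofInjective φ hinj).apply_symm_apply ⟨x * y, h (mulSub_mem x.2 y.2)⟩)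

/-- The linear map on `X ⊗_B Y` induced by a balanced bilinear map. -/
def balancedLift {X : GradedBimodule.{uk, uG, uA, uB, uX} 𝒜 ℬ}
    {Y : GradedBimodule.{uk, uG, uB, uA, uY} ℬ 𝒜} (m : X.carrier →ₗ[k] Y.carrier →ₗ[k] A)
    (hm : ∀ x b y, m (X.right x b) y = m x (Y.left b y)) : BalancedTensor X Y →ₗ[k] A :=
  Submodule.liftQ _ (TensorProduct.lift m) (by
    rw [Submodule.span_le]
    rintro _ ⟨x, b, y, rfl⟩
    simp [hm])

theorem balancedLift_tmul {X : GradedBimodule.{uk, uG, uA, uB, uX} 𝒜 ℬ}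
    {Y : GradedBimodule.{uk, uG, uB, uA, uY} ℬ 𝒜} (m : X.carrier →ₗ[k] Y.carrier →ₗ[k] A)
    (hm : ∀ x b y, m (X.right x b) y = m x (Y.left b y)) (x : X.carrier) (y : Y.carrier) :
    balancedLift m hm (balancedTmul X Y x y) = m x y := rfl

/-- Removes the balanced tensor product: images of `τ` are computed from the bilinear pairing alone.
-/
theorem map_balancedLift {X : GradedBimodule.{uk, uG, uA, uB, uX} 𝒜 ℬ}
    {Y : GradedBimodule.{uk, uG, uB, uA, uY} ℬ 𝒜} (m : X.carrier →ₗ[k] Y.carrier →ₗ[k] A)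
    (hm : ∀ x b y, m (X.right x b) y = m x (Y.left b y)) (P : Submodule k X.carrier)
    (Q : Submodule k Y.carrier) :
    (balancedSub X Y P Q).map (balancedLift m hm) = Submodule.map₂ m P Q := by
  rw [balancedSub, Submodule.map_map₂]
  rfl

/-- The analogue of `map_map₂_subtype` for the module actions, whose values lie in a submodule of
`R`. It translates the conditions `D_t X_t = X_t` into `R`. -/
theorem map_subtype_map₂ {P : Submodule k R} {M N : Type*} [AddCommGroup M] [Module k M]
    [AddCommGroup N] [Module k N] (f : M →ₗ[k] N →ₗ[k] P) (M' : Submodule k M)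
    (N' : Submodule k N) {U V : Submodule k R} (u : M →ₗ[k] R) (v : N →ₗ[k] R)
    (hf : ∀ x y, (f x y : R) = u x * v y) (hU : M'.map u = U) (hV : N'.map v = V) :
    (Submodule.map₂ f M' N').map P.subtype = U ⬝ₛ V := by
  subst hU hV
  rw [Submodule.map_map₂, mulSub, Submodule.map₂_map_map]
  congr 1
  ext x y
  exact hf x y

theorem map_subtype_comap_subtype {P P' : Submodule k R} (h : P' ≤ P) :
    (P'.comap P.subtype).map P.subtype = P' := by
  rw [Submodule.map_comap_eq, Submodule.range_subtype, inf_eq_right.2 h]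

theorem surjective_balancedLift {X : GradedBimodule.{uk, uG, uA, uB, uX} 𝒜 ℬ}
    {Y : GradedBimodule.{uk, uG, uB, uA, uY} ℬ 𝒜} (m : X.carrier →ₗ[k] Y.carrier →ₗ[k] A)
    (hm : ∀ x b y, m (X.right x b) y = m x (Y.left b y))
    (h : ∀ t, ∃ P Q, 𝒜.comp t ≤ Submodule.map₂ m P Q) :
    Function.Surjective (balancedLift m hm) := by
  rw [← LinearMap.range_eq_top, eq_top_iff, ← 𝒜.iSup_comp]
  refine iSup_le fun t => ?_
  obtain ⟨P, Q, hPQ⟩ := h t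
  refine hPQ.trans ?_
  rw [← map_balancedLift m hm]
  exact LinearMap.map_le_range

/-- Two partially-strongly-graded algebras `A`, `B` embedded in an algebra `R` are
strongly-graded-equivalent if there are suitable graded subspaces `X = ⨁ P_t` and `Y = ⨁ Q_t` of
`R` on which they act by the multiplication of `R`. -/
theorem stronglyGradedEquivalent_of_embedding
    {A : Type uA} [NonUnitalRing A] [Module k A] [IsScalarTower k A A] [SMulCommClass k A A]
    {R : Type (max uA uB)} [NonUnitalRing R] [Module k R] [IsScalarTower k R R]
    [SMulCommClass k R R] {𝒜 : GroupGrading k G A} {ℬ : GroupGrading k G B}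
    (φ : A →ₗ[k] R) (hφ : ∀ x y, φ (x * y) = φ x * φ y) (hφi : Function.Injective φ)
    (ψ : B →ₗ[k] R) (hψ : ∀ x y, ψ (x * y) = ψ x * ψ y) (hψi : Function.Injective ψ)
    {a b P Q : G → Submodule k R} (ha : ∀ t, (𝒜.comp t).map φ = a t)
    (hb : ∀ t, (ℬ.comp t).map ψ = b t) (hP : iSupIndep P) (hQ : iSupIndep Q)
    (haa : ∀ t, a t = a t ⬝ₛ a t⁻¹ ⬝ₛ a t) (hbb : ∀ t, b t = b t ⬝ₛ b t⁻¹ ⬝ₛ b t)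
    (haP : ∀ s t, a s ⬝ₛ P t ≤ P (s * t)) (hPb : ∀ s t, P s ⬝ₛ b t ≤ P (s * t))
    (hbQ : ∀ s t, b s ⬝ₛ Q t ≤ Q (s * t)) (hQa : ∀ s t, Q s ⬝ₛ a t ≤ Q (s * t))
    (hPQ : ∀ s t, P s ⬝ₛ Q t ≤ a (s * t)) (hQP : ∀ s t, Q s ⬝ₛ P t ≤ b (s * t))
    (hPQ' : ∀ t, P t ⬝ₛ Q t⁻¹ = a t ⬝ₛ a t⁻¹) (hQP' : ∀ t, Q t ⬝ₛ P t⁻¹ = b t ⬝ₛ b t⁻¹)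
    (hPQ1 : ∀ t, a t ≤ P t ⬝ₛ Q 1) (hQP1 : ∀ t, b t ≤ Q t ⬝ₛ P 1)
    (haaP : ∀ t, a t ⬝ₛ a t⁻¹ ⬝ₛ P t = P t) (hPbb : ∀ t, P t ⬝ₛ (b t⁻¹ ⬝ₛ b t) = P t)
    (hbbQ : ∀ t, b t ⬝ₛ b t⁻¹ ⬝ₛ Q t = Q t) (hQaa : ∀ t, Q t ⬝ₛ (a t⁻¹ ⬝ₛ a t) = Q t) :
    StronglyGradedEquivalent 𝒜 ℬ := by
  obtain rfl : (fun t => (𝒜.comp t).map φ) = a := funext ha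
  obtain rfl : (fun t => (ℬ.comp t).map ψ) = b := funext hb
  have hA : 𝒜.IsPartiallyStronglyGraded := .of_map φ hφ hφi haa
  have hB : ℬ.IsPartiallyStronglyGraded := .of_map ψ hψ hψi hbb
  have hideal : ∀ t, (𝒜.ideal t).map φ = (𝒜.comp t).map φ ⬝ₛ (𝒜.comp t⁻¹).map φ :=
    fun t => map_mulSub _ hφ _ _
  have hideal' : ∀ t, (ℬ.ideal t).map ψ = (ℬ.comp t).map ψ ⬝ₛ (ℬ.comp t⁻¹).map ψ :=
    fun t => map_mulSub _ hψ _ _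
  refine ⟨hA.isIdempotentAlgebra, hB.isIdempotentAlgebra, hA.ideal_idem, hB.ideal_idem, ?_⟩
  have hPQr : (⨆ t, P t) ⬝ₛ (⨆ t, Q t) ≤ LinearMap.range φ :=
    (mulSub_iSup_le hPQ).trans (𝒜.iSup_map_comp φ).le
  have hQPr : (⨆ t, Q t) ⬝ₛ (⨆ t, P t) ≤ LinearMap.range ψ :=
    (mulSub_iSup_le hQP).trans (ℬ.iSup_map_comp ψ).le
  let X : GradedBimodule.{uk, uG, uA, uB, max uA uB} 𝒜 ℬ :=
    GradedBimodule.ofSubmodules φ hφ ψ hψ P hP haP hPb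
  let Y : GradedBimodule.{uk, uG, uB, uA, max uA uB} ℬ 𝒜 :=
    GradedBimodule.ofSubmodules ψ hψ φ hφ Q hQ hbQ hQa
  let mA : X.carrier →ₗ[k] Y.carrier →ₗ[k] A := mulInto φ hφi hPQr
  let mB : Y.carrier →ₗ[k] X.carrier →ₗ[k] B := mulInto ψ hψi hQPr
  have hmA : ∀ x y, φ (mA x y) = x.1 * y.1 := apply_mulInto φ hφi hPQr
  have hmB : ∀ y x, ψ (mB y x) = y.1 * x.1 := apply_mulInto ψ hψi hQPr
  have hXl : ∀ a x, (X.left a x).1 = φ a * x.1 := fun _ _ => rfl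
  have hXr : ∀ x b, (X.right x b).1 = x.1 * ψ b := fun _ _ => rfl
  have hYl : ∀ b y, (Y.left b y).1 = ψ b * y.1 := fun _ _ => rfl
  have hYr : ∀ y a, (Y.right y a).1 = y.1 * φ a := fun _ _ => rfl
  -- Balancedness, like all the compatibilities of the context, is associativity in `R`, tested
  -- after an injective map.
  have hbA : ∀ x b y, mA (X.right x b) y = mA x (Y.left b y) := fun x b y =>
    hφi (by rw [hmA, hmA, hXr, hYl, mul_assoc])
  have hbB : ∀ y a x, mB (Y.right y a) x = mB y (X.left a x) := fun y a x =>
    hψi (by rw [hmB, hmB, hYr, hXl, mul_assoc])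
  have hXc : ∀ t, (X.comp t).map (⨆ t, P t).subtype = P t := fun t =>
    map_subtype_comap_subtype (le_iSup P t)
  have hYc : ∀ t, (Y.comp t).map (⨆ t, Q t).subtype = Q t := fun t =>
    map_subtype_comap_subtype (le_iSup Q t)
  have hτA : ∀ s t, (Submodule.map₂ mA (X.comp s) (Y.comp t)).map φ = P s ⬝ₛ Q t := fun s t =>
    map_map₂_subtype mA φ hmA (le_iSup P s) (le_iSup Q t)
  have hτB : ∀ s t, (Submodule.map₂ mB (Y.comp s) (X.comp t)).map ψ = Q s ⬝ₛ P t := fun s t =>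
    map_map₂_subtype mB ψ hmB (le_iSup Q s) (le_iSup P t)
  have hφm := Submodule.map_injective_of_injective hφi
  have hψm := Submodule.map_injective_of_injective hψi
  let M : GradedMoritaContext.{uk, uG, uA, uB, max uA uB, max uA uB} 𝒜 ℬ :=
    { X := X
      Y := Y
      τA := balancedLift mA hbA
      τB := balancedLift mB hbB
      τA_left := fun a x y => hφi (by
        rw [balancedLift_tmul, balancedLift_tmul, hφ, hmA, hmA, hXl, mul_assoc])
      τA_right := fun x y a => hφi (by
        rw [balancedLift_tmul, balancedLift_tmul, hφ, hmA, hmA, hYr, mul_assoc])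
      τB_left := fun b y x => hψi (by
        rw [balancedLift_tmul, balancedLift_tmul, hψ, hmB, hmB, hYl, mul_assoc])
      τB_right := fun y x b => hψi (by
        rw [balancedLift_tmul, balancedLift_tmul, hψ, hmB, hmB, hXr, mul_assoc])
      assocX := fun x y x' => Subtype.ext (by
        rw [balancedLift_tmul, balancedLift_tmul, hXl, hXr, hmA, hmB, mul_assoc])
      assocY := fun y x y' => Subtype.ext (by
        rw [balancedLift_tmul, balancedLift_tmul, hYl, hYr, hmA, hmB, mul_assoc])
      τA_mem := fun r s => by
        rw [map_balancedLift, ← Submodule.map_le_map_iff_of_injective hφi, hτA]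
        exact hPQ r s
      τB_mem := fun r s => by
        rw [map_balancedLift, ← Submodule.map_le_map_iff_of_injective hψi, hτB]
        exact hQP r s }
  refine ⟨M, ⟨fun t => ?_, fun t => ?_, fun t => ?_, fun t => ?_⟩, ?_, ?_, fun t => ?_, fun t => ?_⟩
  · refine Submodule.map_injective_of_injective (Submodule.subtype_injective (⨆ t, P t)) ?_
    exact (map_subtype_map₂ X.left _ _ φ _ hXl (hideal t) (hXc t)).trans
      ((haaP t).trans (hXc t).symm)
  · refine Submodule.map_injective_of_injective (Submodule.subtype_injective (⨆ t, P t)) ?_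
    refine (map_subtype_map₂ X.right _ _ _ ψ hXr (hXc t) (hideal' t⁻¹)).trans ?_
    -- The ideal acting here is `D_{t⁻¹} = B_{t⁻¹} B_{(t⁻¹)⁻¹}`.
    rw [inv_inv]
    exact (hPbb t).trans (hXc t).symm
  · refine Submodule.map_injective_of_injective (Submodule.subtype_injective (⨆ t, Q t)) ?_
    exact (map_subtype_map₂ Y.left _ _ ψ _ hYl (hideal' t) (hYc t)).trans
      ((hbbQ t).trans (hYc t).symm)
  · refine Submodule.map_injective_of_injective (Submodule.subtype_injective (⨆ t, Q t)) ?_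
    refine (map_subtype_map₂ Y.right _ _ _ φ hYr (hYc t) (hideal t⁻¹)).trans ?_
    rw [inv_inv]
    exact (hQaa t).trans (hYc t).symm
  -- The pairs `X_t`, `Y_{t⁻¹}` only reach degree `1`; degree `t` is reached by pairing `X_t` with
  -- `Y_1`.
  · refine surjective_balancedLift mA hbA fun t => ⟨X.comp t, Y.comp 1, ?_⟩
    rw [← Submodule.map_le_map_iff_of_injective hφi, hτA]
    exact hPQ1 t
  · refine surjective_balancedLift mB hbB fun t => ⟨Y.comp t, X.comp 1, ?_⟩
    rw [← Submodule.map_le_map_iff_of_injective hψi, hτB]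
    exact hQP1 t
  · exact hφm ((congrArg _ (map_balancedLift mA hbA _ _)).trans
      ((hτA t t⁻¹).trans ((hPQ' t).trans (hideal t).symm)))
  · exact hψm ((congrArg _ (map_balancedLift mB hbB _ _)).trans
      ((hτB t t⁻¹).trans ((hQP' t).trans (hideal' t).symm)))

end Embedded

/-! ### Matrices with entries in prescribed submodules -/

section Matrices

variable {k : Type uk} [CommRing k] {G : Type uG} [Group G]
  {B : Type uB} [NonUnitalRing B] [Module k B] [IsScalarTower k B B] [SMulCommClass k B B]

namespace FMat

/-- The matrices with entries in prescribed submodules. -/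
def entriesIn (S : G → G → Submodule k B) : Submodule k (FMat G B) where
  carrier := {M | ∀ r s, entry r s M ∈ S r s}
  add_mem' hM hN r s := by rw [map_add]; exact add_mem (hM r s) (hN r s)
  zero_mem' r s := by rw [map_zero]; exact zero_mem _
  smul_mem' c M hM r s := by rw [entry_smul]; exact Submodule.smul_mem _ c (hM r s)

theorem unit_mem_entriesIn {S : G → G → Submodule k B} {r s : G} {b : B} (hb : b ∈ S r s) :
    unit r s b ∈ entriesIn S :=
  unit_mem hb

variable (k) in
/-- `entry r s` as a `k`-linear map. -/
def entryₗ (r s : G) : FMat G B →ₗ[k] B := { entry r s with map_smul' := fun _ _ => rfl }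

variable (k) in
/-- `unit r s` as a `k`-linear map. -/
def unitₗ (r s : G) : B →ₗ[k] FMat G B :=
  { unit r s with map_smul' := fun c b => (smul_unit c r s b).symm }

theorem entriesIn_le {S : G → G → Submodule k B} {P : Submodule k (FMat G B)}
    (h : ∀ r s, S r s ≤ P.comap (unitₗ k r s)) : entriesIn S ≤ P := fun M hM =>
  induction_mem (S := fun r s => (S r s).toAddSubgroup) (p := (· ∈ P)) M hM P.zero_mem
    (fun _ _ => P.add_mem) fun r s _ hb => h r s hb

/-- An entry of a product is a finite sum over the middle index `w`; conversely each summand is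
realised by `(b e_{r,w}) (c e_{w,s}) = bc e_{r,s}`. -/
theorem entriesIn_mulSub_entriesIn (S T : G → G → Submodule k B) :
    entriesIn S ⬝ₛ entriesIn T = entriesIn fun r s => ⨆ w, S r w ⬝ₛ T w s := by
  apply le_antisymm
  · exact mulSub_le.2 fun M hM N hN r s => entry_mul_mem _ M N r s fun w =>
      le_iSup (fun w => S r w ⬝ₛ T w s) w (mulSub_mem (hM r w) (hN w s))
  · refine entriesIn_le fun r s => iSup_le fun w => mulSub_le.2 fun b hb c hc => ?_
    have h : unitₗ k r s (b * c) = unit r w b * unit w s c := by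
      rw [unit_mul_unit, if_pos rfl]; rfl
    rw [Submodule.mem_comap, h]
    exact mulSub_mem (unit_mem_entriesIn hb) (unit_mem_entriesIn hc)

/-- The linear map `b e_{r,s} ↦ b e_{r,t⁻¹s}` on matrices. -/
def shift (k : Type uk) [CommRing k] (G : Type uG) [Group G] (B : Type uB) [NonUnitalRing B]
    [Module k B] (t : G) : FMat G B →ₗ[k] FMat G B :=
  Finsupp.lmapDomain B k fun p : G × G => (p.1, t⁻¹ * p.2)

theorem entry_shift (t r s : G) (M : FMat G B) :
    entry r s (shift k G B t M) = entry r (t * s) M := by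
  have hinj : Function.Injective fun p : G × G => (p.1, t⁻¹ * p.2) := by
    rintro ⟨a, b⟩ ⟨c, d⟩ h
    simpa using h
  have := Finsupp.mapDomain_apply hinj M (r, t * s)
  simp only [inv_mul_cancel_left] at this
  exact this

theorem shift_injective (t : G) : Function.Injective (shift k G B t) := fun M N h => by
  apply FMat.ext
  intro r s
  have := congrArg (entry r (t⁻¹ * s)) h
  rwa [entry_shift, entry_shift, mul_inv_cancel_left] at this

theorem map_shift_entriesIn (t : G) (S : G → G → Submodule k B) :
    (entriesIn S).map (shift k G B t) = entriesIn fun r s => S r (t * s) := by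
  apply le_antisymm
  · rintro _ ⟨M, hM, rfl⟩ r s
    rw [entry_shift]
    exact hM r (t * s)
  · intro M hM
    refine ⟨shift k G B t⁻¹ M, fun r s => ?_, ?_⟩
    · rw [entry_shift]
      simpa using hM r (t⁻¹ * s)
    · apply FMat.ext
      intro r s
      rw [entry_shift, entry_shift, inv_mul_cancel_left]

/-- Formally this is `M U_s N U_t = M (U_s N U_s⁻¹) U_{st}` with `U_t = ∑_w e_{tw,w}`. Since `B`
need not have a unit and `U_t` need not be finitely supported, the identity is checked on entries,
by the substitution `w ↦ sw` of the summation index. -/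
theorem shift_mul_shift (s t : G) (M N : FMat G B) :
    shift k G B s M * shift k G B t N =
      shift k G B (s * t) (M * FMat.translate k G B s N) := by
  apply FMat.ext
  intro u v
  rw [entry_shift, entry_mul, entry_mul]
  simp only [entry_shift, entry_translate]
  refine (finsum_congr fun w => ?_).trans (finsum_comp_equiv (Equiv.mulLeft s))
  simp [mul_assoc]

end FMat

/-! ### Corners of the matrix algebra and their products -/

variable {ℬ : GroupGrading k G B}

namespace GroupGrading.IsPartiallyStronglyGraded

theorem comp_one_mulSub (h : ℬ.IsPartiallyStronglyGraded) (t : G) :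
    ℬ.comp 1 ⬝ₛ ℬ.comp t = ℬ.comp t :=
  le_antisymm (ℬ.mulSub_comp_le' (_root_.one_mul t)) (h.one_mul t)

/-- `B_t = B_t (B_{t⁻¹} B_t) ⊆ B_t B_1`. In the absence of a unit, `B_1` plays its role in the
products of corners. -/
theorem mulSub_comp_one (h : ℬ.IsPartiallyStronglyGraded) (t : G) :
    ℬ.comp t ⬝ₛ ℬ.comp 1 = ℬ.comp t := by
  refine le_antisymm (ℬ.mulSub_comp_le' (_root_.mul_one t)) ?_
  conv_lhs => rw [h t, mulSub_assoc]
  exact mulSub_mono le_rfl (ℬ.mulSub_comp_le' (inv_mul_cancel t))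

/-- One inclusion is `B_{t⁻¹} B_{ts} ⊆ B_s`; for the other, `B_t` is replaced by `B_t B_{t⁻¹} B_t`.
This identity simplifies the entries of `D_t` after the column shift. -/
theorem mulSub_mulSub_comp (h : ℬ.IsPartiallyStronglyGraded) (s t : G) :
    ℬ.comp t ⬝ₛ ℬ.comp t⁻¹ ⬝ₛ ℬ.comp (t * s) = ℬ.comp t ⬝ₛ ℬ.comp s := by
  apply le_antisymm
  · rw [mulSub_assoc]
    exact mulSub_mono le_rfl (ℬ.mulSub_comp_le' (inv_mul_cancel_left t s))
  · conv_lhs => rw [h t, mulSub_assoc]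
    exact mulSub_mono le_rfl (ℬ.mulSub_comp_le t s)

end GroupGrading.IsPartiallyStronglyGraded

/-- The matrices with entries in `B_{r⁻¹} V B_s` at the positions `(r, s) ∈ P × Q`, and zero
elsewhere. -/
def corner (ℬ : GroupGrading k G B) (P Q : Set G) (V : Submodule k B) : Submodule k (FMat G B) :=
  FMat.entriesIn fun r s => ⨆ (_ : r ∈ P) (_ : s ∈ Q), ℬ.comp r⁻¹ ⬝ₛ V ⬝ₛ ℬ.comp s

theorem corner_mono {P P' Q Q' : Set G} {V V' : Submodule k B} (hP : P ⊆ P') (hQ : Q ⊆ Q')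
    (hV : V ≤ V') : corner ℬ P Q V ≤ corner ℬ P' Q' V' := fun _ hM r s =>
  (iSup₂_le fun hr hs => (mulSub_mono (mulSub_mono le_rfl hV) le_rfl).trans
    (le_iSup₂ (f := fun (_ : r ∈ P') (_ : s ∈ Q') => ℬ.comp r⁻¹ ⬝ₛ V' ⬝ₛ ℬ.comp s)
      (hP hr) (hQ hs)) : _ ≤ _) (hM r s)

/-- The middle index `w` contributes `V B_w B_{w⁻¹} W`, which lies in `V B_1 W = V W`; the index `w
= 1` already gives all of `V W`. Hence `Q` leaves no trace in the product. -/
theorem corner_mulSub_corner {P Q R : Set G} {V W : Submodule k B} (hQ : (1 : G) ∈ Q)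
    (hV : V ⬝ₛ ℬ.comp 1 = V) : corner ℬ P Q V ⬝ₛ corner ℬ Q R W = corner ℬ P R (V ⬝ₛ W) := by
  unfold corner
  rw [FMat.entriesIn_mulSub_entriesIn]
  congr 1
  funext r s
  by_cases hr : r ∈ P
  swap
  · simp [hr, mulSub]
  by_cases hs : s ∈ R
  swap
  · simp [hs, mulSub]
  simp only [hr, hs, iSup_pos]
  apply le_antisymm
  · refine iSup_le fun w => ?_
    by_cases hw : w ∈ Q
    swap
    · simp [hw, mulSub]
    simp only [hw, iSup_pos]
    have h : ℬ.comp w ⬝ₛ ℬ.comp w⁻¹ ≤ ℬ.comp 1 := ℬ.mulSub_comp_le' (mul_inv_cancel w)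
    calc ℬ.comp r⁻¹ ⬝ₛ V ⬝ₛ ℬ.comp w ⬝ₛ (ℬ.comp w⁻¹ ⬝ₛ W ⬝ₛ ℬ.comp s)
        = ℬ.comp r⁻¹ ⬝ₛ (V ⬝ₛ (ℬ.comp w ⬝ₛ ℬ.comp w⁻¹) ⬝ₛ W) ⬝ₛ ℬ.comp s := by
          simp only [mulSub_assoc]
      _ ≤ ℬ.comp r⁻¹ ⬝ₛ (V ⬝ₛ ℬ.comp 1 ⬝ₛ W) ⬝ₛ ℬ.comp s :=
          mulSub_mono (mulSub_mono le_rfl (mulSub_mono (mulSub_mono le_rfl h) le_rfl)) le_rfl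
      _ = _ := by rw [hV]
  -- At `w = 1` the two middle factors are both `B_1`, and `V` absorbs them one after the other.
  · refine le_trans (le_of_eq ?_) (le_iSup _ 1)
    simp only [hQ, iSup_pos, inv_one]
    calc ℬ.comp r⁻¹ ⬝ₛ (V ⬝ₛ W) ⬝ₛ ℬ.comp s
        = ℬ.comp r⁻¹ ⬝ₛ (V ⬝ₛ ℬ.comp 1 ⬝ₛ ℬ.comp 1 ⬝ₛ W) ⬝ₛ ℬ.comp s := by rw [hV, hV]
      _ = _ := by simp only [mulSub_assoc]

open scoped Classical in
-- The `(r, s)`-entry of a matrix in the `t`-th corner lies in `B_{r⁻¹ts}`, and `t ↦ r⁻¹ts` is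
-- injective, so independence is inherited from the grading of `B`, entry by entry.
theorem iSupIndep_corner (P Q : Set G) : iSupIndep fun t => corner ℬ P Q (ℬ.comp t) := by
  refine iSupIndep_of_jointly_injective (κ := G × G)
    (P' := fun p t => ℬ.comp (p.1⁻¹ * t * p.2)) (fun p => FMat.entryₗ k p.1 p.2)
    (fun M hM => FMat.ext fun r s => hM (r, s)) (fun p => ?_) fun p t M hM => ?_
  · refine ℬ.isInternal.submodule_iSupIndep.comp (f := fun t => p.1⁻¹ * t * p.2) ?_
    intro s t h
    simpa using h
  · have hle : (⨆ (_ : p.1 ∈ P) (_ : p.2 ∈ Q), ℬ.comp p.1⁻¹ ⬝ₛ ℬ.comp t ⬝ₛ ℬ.comp p.2) ≤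
        ℬ.comp (p.1⁻¹ * t * p.2) := iSup₂_le fun _ _ =>
      (mulSub_mono (ℬ.mulSub_comp_le _ _) le_rfl).trans (ℬ.mulSub_comp_le _ _)
    exact hle (hM p.1 p.2)

theorem map_unitₗ_comp (h : ℬ.IsPartiallyStronglyGraded) (t : G) :
    (ℬ.comp t).map (FMat.unitₗ k 1 1) = corner ℬ {1} {1} (ℬ.comp t) := by
  apply le_antisymm
  · rw [Submodule.map_le_iff_le_comap]
    intro b hb
    refine FMat.unit_mem_entriesIn ?_
    simpa [h.comp_one_mulSub, h.mulSub_comp_one] using hb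
  · refine FMat.entriesIn_le fun r s => iSup₂_le ?_
    rintro rfl rfl
    rw [inv_one, h.comp_one_mulSub, h.mulSub_comp_one]
    exact Submodule.le_comap_map _ _

end Matrices

/-! ### The skew group algebra of the canonical partial action as an algebra of matrices -/

section Skew

variable {k : Type uk} [CommRing k] {G : Type uG} [Group G]
  {B : Type uB} [NonUnitalRing B] [Module k B] [IsScalarTower k B B] [SMulCommClass k B B]
  {ℬ : GroupGrading k G B}

/-- This describes the domains of the canonical partial action inside the full matrix algebra. The
product `I β_t(I)` has `(r, s)`-entries in the sum over `w` of `B_{r⁻¹} B_w B_{w⁻¹t} B_{t⁻¹s}`, and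
the term `w = 1` contains all the others. -/
theorem map_translate_partialSmash (h : ℬ.IsPartiallyStronglyGraded) (t : G) :
    ((dualAction ℬ).translate (partialSmash ℬ) t).map (smash ℬ).toSubmodule.subtype =
      FMat.entriesIn fun r s => ℬ.comp r⁻¹ ⬝ₛ (ℬ.comp t ⬝ₛ ℬ.comp t⁻¹) ⬝ₛ ℬ.comp s := by
  have hI : ((partialSmash ℬ).toSubmodule).map (smash ℬ).toSubmodule.subtype =
      FMat.entriesIn fun r s => ℬ.comp r⁻¹ ⬝ₛ ℬ.comp s := by
    ext M
    constructor
    · rintro ⟨N, hN, rfl⟩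
      exact hN
    · exact fun hM => ⟨⟨M, fun r s => ℬ.mulSub_comp_le _ _ (hM r s)⟩, hM, rfl⟩
  have hI' : ((partialSmash ℬ).toSubmodule.map ((dualAction ℬ).act t)).map
      (smash ℬ).toSubmodule.subtype =
      FMat.entriesIn fun r s => ℬ.comp (r⁻¹ * t) ⬝ₛ ℬ.comp (t⁻¹ * s) := by
    rw [map_partialSmash]
    ext M
    constructor
    · rintro ⟨N, hN, rfl⟩
      exact hN
    · exact fun hM => ⟨⟨M, fun r s => ℬ.mulSub_comp_le' (by group) (hM r s)⟩, hM, rfl⟩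
  refine (GlobalAction.map_incl_mulSub (I := smash ℬ) _ _).trans ?_
  rw [hI, hI', FMat.entriesIn_mulSub_entriesIn]
  congr 1
  funext r s
  apply le_antisymm
  · refine iSup_le fun w => ?_
    calc ℬ.comp r⁻¹ ⬝ₛ ℬ.comp w ⬝ₛ (ℬ.comp (w⁻¹ * t) ⬝ₛ ℬ.comp (t⁻¹ * s))
        = ℬ.comp r⁻¹ ⬝ₛ (ℬ.comp w ⬝ₛ ℬ.comp (w⁻¹ * t)) ⬝ₛ ℬ.comp (t⁻¹ * s) := by
          simp only [mulSub_assoc]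
      _ ≤ ℬ.comp r⁻¹ ⬝ₛ ℬ.comp t ⬝ₛ ℬ.comp (t⁻¹ * s) :=
          mulSub_mono (mulSub_mono le_rfl (ℬ.mulSub_comp_le' (by group))) le_rfl
      -- Writing `B_t` as `B_t B_{t⁻¹} B_t` leaves a spare `B_t` to be merged with `B_{t⁻¹s}` into
      -- `B_s`.
      _ = ℬ.comp r⁻¹ ⬝ₛ (ℬ.comp t ⬝ₛ ℬ.comp t⁻¹) ⬝ₛ (ℬ.comp t ⬝ₛ ℬ.comp (t⁻¹ * s)) := by
          conv_lhs => rw [h t]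
          simp only [mulSub_assoc]
      _ ≤ _ := mulSub_mono le_rfl (ℬ.mulSub_comp_le' (by group))
  · refine le_trans ?_ (le_iSup _ 1)
    rw [h.mulSub_comp_one, inv_one, one_mul]
    calc ℬ.comp r⁻¹ ⬝ₛ (ℬ.comp t ⬝ₛ ℬ.comp t⁻¹) ⬝ₛ ℬ.comp s
        = ℬ.comp r⁻¹ ⬝ₛ (ℬ.comp t ⬝ₛ (ℬ.comp t⁻¹ ⬝ₛ ℬ.comp s)) := by
          simp only [mulSub_assoc]
      _ ≤ _ := mulSub_mono le_rfl (mulSub_mono le_rfl (ℬ.mulSub_comp_le _ _))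

variable (h : ℬ.IsPartiallyStronglyGraded)

/-- The map `b e_{r,s} δ_t ↦ b e_{r,t⁻¹s}` on the component of degree `t`. -/
def skewComponentToMatrix (t : G) : (canonicalPartialAction h).D t →ₗ[k] FMat G B :=
  FMat.shift k G B t ∘ₗ (smash ℬ).toSubmodule.subtype ∘ₗ
    (partialSmash ℬ).toSubmodule.subtype ∘ₗ ((canonicalPartialAction h).D t).subtype

theorem skewComponentToMatrix_injective (t : G) :
    Function.Injective (skewComponentToMatrix h t) := by
  intro x y hxy
  exact Subtype.ext (Subtype.ext (Subtype.ext (FMat.shift_injective (k := k) t hxy)))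

/-- The shift turns the entry condition `B_{r⁻¹} B_t B_{t⁻¹} B_s` into `B_{r⁻¹} B_t B_{t⁻¹} B_{ts}`,
which is `B_{r⁻¹} B_t B_s` by `mulSub_mulSub_comp`. -/
theorem range_skewComponentToMatrix (t : G) :
    LinearMap.range (skewComponentToMatrix h t) = corner ℬ Set.univ Set.univ (ℬ.comp t) := by
  have hD : ((canonicalPartialAction h).D t).map (partialSmash ℬ).toSubmodule.subtype =
      (dualAction ℬ).translate (partialSmash ℬ) t :=
    (partialSmash_isRestrictable h).map_comap t
  unfold skewComponentToMatrix
  rw [LinearMap.range_comp, LinearMap.range_comp, LinearMap.range_comp, Submodule.range_subtype]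
  erw [hD]
  rw [map_translate_partialSmash h, FMat.map_shift_entriesIn]
  unfold corner
  congr 1
  funext r s
  simp only [Set.mem_univ, iSup_pos]
  rw [mulSub_assoc, h.mulSub_mulSub_comp, mulSub_assoc]

open scoped Classical in
/-- The embedding `b e_{r,s} δ_t ↦ b e_{r,t⁻¹s}` of the skew group algebra into the matrices. -/
def skewToMatrix : (canonicalPartialAction h).SkewGroupAlgebra →ₗ[k] FMat G B :=
  DirectSum.toModule k G _ (skewComponentToMatrix h)

open ProductPartialAction.SkewGroupAlgebra

theorem skewToMatrix_δ (t : G) (a : (canonicalPartialAction h).D t) :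
    skewToMatrix h (δ (canonicalPartialAction h) t a) = FMat.shift k G B t a.1.1.1 := by
  unfold skewToMatrix δ
  erw [DirectSum.toModule_lof]
  rfl

theorem skewToMatrix_injective : Function.Injective (skewToMatrix h) := by
  classical
  have hind : iSupIndep fun t => LinearMap.range (skewComponentToMatrix h t) := by
    simp only [range_skewComponentToMatrix]
    exact iSupIndep_corner _ _
  exact toModule_injective (E := fun t => (canonicalPartialAction h).D t)
    (skewComponentToMatrix h) (skewComponentToMatrix_injective h) hind

/-- Since the partial action restricts a global one, `α_s(α_s⁻¹(a) b)` can be expanded in `B # G`,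
where `β_s(b)` makes sense without any condition on domains. -/
theorem coeffMul_canonicalPartialAction (s t : G) (a : (canonicalPartialAction h).D s)
    (b : (canonicalPartialAction h).D t) :
    (coeffMul (canonicalPartialAction h) s t a b).1.1 =
      a.1.1 * (dualAction ℬ).act s b.1.1 := by
  change (dualAction ℬ).act s ((dualAction ℬ).act s⁻¹ a.1.1 * b.1.1) = _
  rw [(dualAction ℬ).act_mul, GlobalAction.act_act, mul_inv_cancel, map_one]
  rfl

/-- On homogeneous elements this is the covariance relation `FMat.shift_mul_shift`, because the
product there is `a β_s(b) δ_{st}`. -/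
theorem skewToMatrix_mul (x y : (canonicalPartialAction h).SkewGroupAlgebra) :
    skewToMatrix h (x * y) = skewToMatrix h x * skewToMatrix h y := by
  induction x using induction_δ with
  | h0 => simp
  | hadd x x' hx hx' => simp only [map_add, add_mul, hx, hx']
  | hδ s a =>
    induction y using induction_δ with
    | h0 => simp
    | hadd y y' hy hy' => simp only [map_add, mul_add, hy, hy']
    | hδ t b =>
      rw [δ_mul_δ, skewToMatrix_δ, skewToMatrix_δ, skewToMatrix_δ,
        coeffMul_canonicalPartialAction, FMat.shift_mul_shift]
      rfl

theorem map_skewToMatrix_comp (t : G) :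
    ((grading (canonicalPartialAction h)).comp t).map (skewToMatrix h) =
      corner ℬ Set.univ Set.univ (ℬ.comp t) := by
  rw [← range_skewComponentToMatrix h t]
  change (LinearMap.range (δ (canonicalPartialAction h) t)).map _ = _
  rw [← LinearMap.range_comp]
  congr 1
  exact LinearMap.ext fun a => skewToMatrix_δ h t a

end Skew

end

/-! ### The Morita context of the first row and the first column -/

theorem mainTheorem4 {k : Type*} [CommRing k] {G : Type*} [Group G] {B : Type*} [NonUnitalRing B]
    [Module k B] [IsScalarTower k B B] [SMulCommClass k B B]
    (ℬ : GroupGrading k G B) (hB : ℬ.IsPartiallyStronglyGraded) :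
    StronglyGradedEquivalent ℬ
      (ProductPartialAction.SkewGroupAlgebra.grading (canonicalPartialAction hB)) := by
  have hone := hB.mulSub_comp_one
  have hone' : ∀ s t, ℬ.comp s ⬝ₛ ℬ.comp t ⬝ₛ ℬ.comp 1 = ℬ.comp s ⬝ₛ ℬ.comp t := fun s t => by
    rw [mulSub_assoc, hone]
  have hinv : ∀ t, ℬ.comp t ⬝ₛ ℬ.comp t⁻¹ ⬝ₛ ℬ.comp t = ℬ.comp t := fun t => (hB t).symm
  have hmul : ∀ {P Q R : Set G} (s t : G), (1 : G) ∈ Q →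
      corner ℬ P Q (ℬ.comp s) ⬝ₛ corner ℬ Q R (ℬ.comp t) =
        corner ℬ P R (ℬ.comp s ⬝ₛ ℬ.comp t) := fun s t hQ => corner_mulSub_corner hQ (hone s)
  have hle : ∀ {P Q R : Set G} (s t : G), (1 : G) ∈ Q →
      corner ℬ P Q (ℬ.comp s) ⬝ₛ corner ℬ Q R (ℬ.comp t) ≤ corner ℬ P R (ℬ.comp (s * t)) :=
    fun s t hQ => (hmul s t hQ).trans_le (corner_mono subset_rfl subset_rfl (ℬ.mulSub_comp_le s t))
  -- For suitable index sets this yields both partially-strong gradings and all four unitality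
  -- conditions on the bimodules.
  have hthree : ∀ {P Q R S : Set G} (t : G), (1 : G) ∈ Q → (1 : G) ∈ R →
      corner ℬ P Q (ℬ.comp t) ⬝ₛ corner ℬ Q R (ℬ.comp t⁻¹) ⬝ₛ corner ℬ R S (ℬ.comp t) =
        corner ℬ P S (ℬ.comp t) := fun t hQ hR => by
    rw [hmul _ _ hQ, corner_mulSub_corner hR (hone' _ _), hinv]
  -- This gives the surjectivity of the two pairings.
  have hunit : ∀ {P Q R : Set G} (t : G), (1 : G) ∈ Q →
      corner ℬ P R (ℬ.comp t) ≤ corner ℬ P Q (ℬ.comp t) ⬝ₛ corner ℬ Q R (ℬ.comp 1) :=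
    fun t hQ => by rw [hmul _ _ hQ, hone]
  have h1 : (1 : G) ∈ ({1} : Set G) := rfl
  have hu : (1 : G) ∈ Set.univ := Set.mem_univ _
  -- `X` consists of matrices supported in row `1`, with `B_t B_s` at `(1, s)` in degree `t`; `Y` of
  -- matrices supported in column `1`, with `B_{r⁻¹} B_t` at `(r, 1)`.
  refine stronglyGradedEquivalent_of_embedding (R := FMat G B)
    (FMat.unitₗ k 1 1) (fun x y => ?_) (fun x y hxy => ?_)
    (skewToMatrix hB) (skewToMatrix_mul hB) (skewToMatrix_injective hB)
    (P := fun t => corner ℬ {1} Set.univ (ℬ.comp t))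
    (Q := fun t => corner ℬ Set.univ {1} (ℬ.comp t))
    (map_unitₗ_comp hB) (map_skewToMatrix_comp hB) (iSupIndep_corner _ _) (iSupIndep_corner _ _)
    (fun t => (hthree t h1 h1).symm) (fun t => (hthree t hu hu).symm)
    (fun s t => hle s t h1) (fun s t => hle s t hu) (fun s t => hle s t hu) (fun s t => hle s t h1)
    (fun s t => hle s t hu) (fun s t => hle s t h1)
    -- `X_t Y_{t⁻¹}` and the ideal `D_t` of the embedded `B` differ only in the intermediate index
    -- set, `G` or `{1}`, which does not affect the product. The same holds, with the two sets
    -- exchanged, for `Y_t X_{t⁻¹}`.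
    (fun t => (hmul t _ hu).trans (hmul t _ h1).symm)
    (fun t => (hmul t _ h1).trans (hmul t _ hu).symm)
    (fun t => hunit t hu) (fun t => hunit t h1) (fun t => hthree t h1 h1)
    (fun t => (mulSub_assoc _ _ _).symm.trans (hthree t hu hu)) (fun t => hthree t hu hu)
    (fun t => (mulSub_assoc _ _ _).symm.trans (hthree t h1 h1))
  · change FMat.unit 1 1 (x * y) = FMat.unit 1 1 x * FMat.unit 1 1 y
    classical rw [FMat.unit_mul_unit, if_pos rfl]
  · exact Finsupp.single_injective _ hxy
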